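/- **Setting.** Fix $d\in\mathbb N$ and $T\in(0,\infty)$. For $t\in[0,T]$ let $\Omega^t=\{\omega\in C([t,T];\mathbb R^d):\omega(t)=0\}$ with the uniform norm $\|\cdot\|_t$, let $B^t$ be the canonical process, $\mathbf F^t=\{\mathcal F^t_s\}_{s\in[t,T]}$ with $\mathcal F^t_s=\sigma(B^t_r;\,r\in[t,s])$, $P^t_0$ the Wiener measure on $\Omega^t$, $E_t$ its expectation, and $\mathscr P(\mathbf F^t)$ the $\mathbf F^t$-progressively measurable $\sigma$-field of $[t,T]\times\Omega^t$. Put $\mathbb Q_{t,T}=([t,T)\cap\mathbb Q)\cup\{T\}$. For $t\le s\le T$ and $\omega\in\Omega^t$, $\widetilde\omega\in\Omega^s$ let $(\Pi_{t,s}\omega)(r)=\omega(r)-\omega(s)$, $r\in[s,T]$, and let $\omega\otimes_s\widetilde\omega\in\Omega^t$ be the path equal to $\omega(r)$ for $r<s$ and to $\omega(s)+\widetilde\omega(r)$ for $r\ge s$. For a process $X=\{X_r\}_{r\in[t,T]}$ on $\Omega^t$ write $X^{s,\omega}_r(\widetilde\omega)=X_r(\omega\otimes_s\widetilde\omega)$,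 $r\in[s,T]$, $\widetilde\omega\in\Omega^s$, and $X^{\tau,\omega}=X^{\tau(\omega),\omega}$ for an $\mathbf F^t$-stopping time $\tau$ with values in $[t,T]$. Let $(\mathbb U,\rho_{\mathbb U})$, $(\mathbb V,\rho_{\mathbb V})$ be separable metric spaces with points $u_0\in\mathbb U$, $v_0\in\mathbb V$ and non-empty subsets $\mathbb U_0\subset\mathbb U$, $\mathbb V_0\subset\mathbb V$; put $[u]_{\mathbb U}=\rho_{\mathbb U}(u,u_0)$ and $[v]_{\mathbb V}=\rho_{\mathbb V}(v,v_0)$. * $\mathcal V^t$ is the set of $\mathbb V$-valued $\mathbf F^t$-progressively measurable processes $\nu$ on $[t,T]\times\Omega^t$ with $\nu_r\in\mathbb V_0$, $dr\times dP^t_0$-a.s., and $E_t\int_t^T[\nu_r]_{\mathbb V}^2\,dr<\infty$. The set $\mathcal U^t$ is defined in the same way from $\mathbb U,u_0,\mathbb U_0$. * $\mathcal A^t$ is the set of $\mathscr P(\mathbf F^t)\otimes\mathscr B(\mathbb V)/\mathscr B(\mathbb U)$-measurable $\alpha:[t,T]\times\Omega^t\times\mathbb V\to\mathbb U$ such that (i)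 $\alpha(r,\omega,\mathbb V_0)\subset\mathbb U_0$, $dr\times dP^t_0$-a.s., and (ii) for some $\kappa>0$ and some non-negative $\mathscr B([t,T])\otimes\mathcal F^t_T$-measurable process $\Psi$ with $E_t\int_t^T\Psi_r^2\,dr<\infty$ one has, $dr\times dP^t_0$-a.s., $[\alpha(r,\omega,v)]_{\mathbb U}\le\Psi_r(\omega)+\kappa[v]_{\mathbb V}$ for all $v\in\mathbb V$. * $\widehat{\mathcal A}^t$ is the set of $\alpha\in\mathcal A^t$ such that for every $\varepsilon>0$ there are $\delta>0$ and a closed $F\subset\Omega^t$ with $P^t_0(F)>1-\varepsilon$ such that $\sup_{r\in[t,T]}\sup_{v\in\mathbb V}\rho_{\mathbb U}(\alpha(r,\omega,v),\alpha(r,\omega',v))<\varepsilon$ for all $\omega,\omega'\in F$ with $\|\omega-\omega'\|_t<\delta$. * $\mathfrak B^t$ and $\widehat{\mathfrak B}^t$ are defined like $\mathcal A^t$ and $\widehat{\mathcal A}^t$ with the roles of $(\mathbb U,u_0,\mathbb U_0)$ and $(\mathbb V,v_0,\mathbb V_0)$ exchanged. * For $\alpha\in\mathcal A^t$ and $\nu\in\mathcal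 V^t$ put $(\alpha\langle\nu\rangle)_r(\omega)=\alpha(r,\omega,\nu_r(\omega))$; for $\beta\in\mathfrak B^t$ and $\mu\in\mathcal U^t$, $\beta\langle\mu\rangle$ is defined in the same way. **Proposition.** Let $t\in[0,T]$ and let $\tau$ be an $\mathbf F^t$-stopping time with values in a countable subset $\{t_n\}_{n\in\mathbb N}$ of $\mathbb Q_{t,T}$. Let $N\in\mathbb N$; for $n=1,\dots,N$ let $A^n_1,\dots,A^n_{\ell_n}\in\mathcal F^t_{t_n}$ be subsets of $\{\tau=t_n\}$, all the sets $A^n_i$ being pairwise disjoint, and put $A_0=\Omega^t\setminus\bigcup_{n=1}^N\bigcup_{i=1}^{\ell_n}A^n_i$. Let $\alpha\in\mathcal A^t$ and $\alpha^n_i\in\mathcal A^{t_n}$ for $n=1,\dots,N$, $i=1,\dots,\ell_n$, and for $v\in\mathbb V$ put $$\widehat\alpha(r,\omega,v)=\begin{cases}\alpha^n_i\big(r,\Pi_{t,t_n}(\omega),v\big), & \text{if } (r,\omega)\in[t_n,T]\times A^n_i \text{ for some } n\le N,\ i\le\ell_n,\\ \alpha(r,\omega,v), & \text{if } r<\tau(\omega),\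 \text{or } r\ge\tau(\omega) \text{ and } \omega\in A_0.\end{cases}$$ 1. $\widehat\alpha$ is well defined and $\widehat\alpha\in\mathcal A^t$. 2. If moreover $\alpha\in\widehat{\mathcal A}^t$ and $\alpha^n_i\in\widehat{\mathcal A}^{t_n}$ for all $n,i$, then $\widehat\alpha\in\widehat{\mathcal A}^t$. 3. For every $\nu\in\mathcal V^t$ the following holds for $P^t_0$-a.e. $\omega\in\Omega^t$. If $\omega\in A^n_i$, then $\nu^{t_n,\omega}\in\mathcal V^{t_n}$ and $(\widehat\alpha\langle\nu\rangle)^{\tau,\omega}_r=(\alpha^n_i\langle\nu^{t_n,\omega}\rangle)_r$ for all $r\in[\tau(\omega),T]$. If $\omega\in A_0$, then $(\widehat\alpha\langle\nu\rangle)^{\tau,\omega}_r=(\alpha\langle\nu\rangle)^{\tau,\omega}_r$ for all $r\in[\tau(\omega),T]$. The same statements hold for player II, i.e. for $\beta\in\mathfrak B^t$ (resp. $\widehat{\mathfrak B}^t$) pasted with $\beta^n_i\in\mathfrak B^{t_n}$ (resp. $\widehat{\mathfrak B}^{t_n}$) along the same sets, and for controls $\mu\in\mathcal U^t$. -/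

import Mathlib

open MeasureTheory ProbabilityTheory Set
open scoped ENNReal

namespace PathGame

/-! ### Canonical path space -/

/-- `PathSpace d t T` is the canonical space of continuous paths `ω : [t, T] → ℝᵈ` with `ω(t) = 0`. -/
def PathSpace (d : ℕ) (t T : ℝ) : Type :=
  {ω : C(Icc t T, EuclideanSpace ℝ (Fin d)) // ∀ r : Icc t T, (r : ℝ) = t → ω r = 0}

namespace PathSpace

variable {d : ℕ} {t T : ℝ}

instance : FunLike (PathSpace d t T) (Icc t T) (EuclideanSpace ℝ (Fin d)) where
  coe ω := ω.1
  coe_injective _ _ h := Subtype.ext (DFunLike.coe_injective h)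

/-- The distance of the uniform norm. -/
noncomputable instance : MetricSpace (PathSpace d t T) :=
  inferInstanceAs (MetricSpace
    {ω : C(Icc t T, EuclideanSpace ℝ (Fin d)) // ∀ r : Icc t T, (r : ℝ) = t → ω r = 0})

noncomputable instance : MeasurableSpace (PathSpace d t T) := borel _

instance : BorelSpace (PathSpace d t T) := ⟨rfl⟩

/-- The canonical process `B_r(ω) = ω(r)`. -/
def canonicalProcess (d : ℕ) (t T : ℝ) (r : Icc t T) (ω : PathSpace d t T) :
    EuclideanSpace ℝ (Fin d) := ω r

theorem continuous_canonicalProcess (r : Icc t T) : Continuous (canonicalProcess d t T r) :=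
  (continuous_eval_const (F := C(Icc t T, EuclideanSpace ℝ (Fin d))) r).comp continuous_subtype_val

/-- The (raw) filtration generated by the canonical process. -/
noncomputable def filtration (d : ℕ) (t T : ℝ) :
    Filtration (Icc t T) (inferInstance : MeasurableSpace (PathSpace d t T)) :=
  Filtration.natural (canonicalProcess d t T)
    (fun r => (continuous_canonicalProcess r).measurable.stronglyMeasurable)

/-- The truncation `(Π_{t,s} ω)(r) = ω(r) - ω(s)`, `r ∈ [s, T]`. -/
def truncate (s : Icc t T) (ω : PathSpace d t T) : PathSpace d (s : ℝ) T :=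
  ⟨⟨fun r => ω ⟨r, s.2.1.trans r.2.1, r.2.2⟩ - ω s,
      (ω.1.continuous.comp (by fun_prop)).sub continuous_const⟩,
    fun r hr => by
      have h : (⟨(r : ℝ), s.2.1.trans r.2.1, r.2.2⟩ : Icc t T) = s := Subtype.ext hr
      change ω _ - ω s = 0
      rw [h, sub_self]⟩

/-- The concatenation of `ω` and `ω'` as a function: `ω(r)` for `r < s` and `ω(s) + ω'(r)` for
`r ≥ s`. -/
noncomputable def concatFun (s : Icc t T) (ω : PathSpace d t T) (ω' : PathSpace d (s : ℝ) T)
    (r : Icc t T) : EuclideanSpace ℝ (Fin d) :=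
  if h : s ≤ r then ω s + ω' ⟨r, h, r.2.2⟩ else ω r

theorem continuous_concatFun (s : Icc t T) (ω : PathSpace d t T) (ω' : PathSpace d (s : ℝ) T) :
    Continuous (concatFun s ω ω') := by
  have key : concatFun s ω ω' = fun r : Icc t T =>
      ω (min r s) + ω' ⟨max (r : ℝ) s, le_max_right _ _, max_le r.2.2 s.2.2⟩ := by
    funext r
    unfold concatFun
    by_cases h : s ≤ r
    · have h2 : max (r : ℝ) s = r := max_eq_left h
      simp only [dif_pos h, min_eq_right h, h2]
    · have h' : r ≤ s := (not_le.mp h).le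
      have h2 : max (r : ℝ) s = s := max_eq_right h'
      have h3 := ω'.2 ⟨max (r : ℝ) s, le_max_right _ _, max_le r.2.2 s.2.2⟩ h2
      rw [dif_neg h, min_eq_left h']
      exact (add_eq_left.mpr h3).symm
  rw [key]
  exact (ω.1.continuous.comp (by fun_prop)).add (ω'.1.continuous.comp (by fun_prop))

/-- The concatenation `ω ⊗ₛ ω'` of `ω ∈ Ωᵗ` and `ω' ∈ Ωˢ` at time `s`. -/
noncomputable def concat (s : Icc t T) (ω : PathSpace d t T) (ω' : PathSpace d (s : ℝ) T) :
    PathSpace d t T :=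
  ⟨⟨concatFun s ω ω', continuous_concatFun s ω ω'⟩, fun r hr => by
    change concatFun s ω ω' r = 0
    unfold concatFun
    split_ifs with h
    · have hs : (s : ℝ) = t := le_antisymm ((show (s : ℝ) ≤ r from h).trans hr.le) s.2.1
      have h1 := ω.2 s hs
      have h2 := ω'.2 ⟨r, h, r.2.2⟩ (hr.trans hs.symm)
      exact (congrArg₂ (· + ·) h1 h2).trans (add_zero 0)
    · exact ω.2 r hr⟩

end PathSpace

open PathSpace

/-! ### Wiener measure -/

/-- `P` is the Wiener measure on `PathSpace d t T`: a probability measure under which the canonical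
process (which starts from `0`) is a `d`-dimensional Brownian motion on `[t, T]`, i.e. has independent
increments with `B_s - B_r ~ N(0, (s - r) I_d)` for `r ≤ s`; the paths are continuous by
construction. -/
structure IsWienerMeasure {d : ℕ} {t T : ℝ} (P : Measure (PathSpace d t T)) : Prop where
  isProbabilityMeasure : IsProbabilityMeasure P
  hasIndepIncrements : HasIndepIncrements (canonicalProcess d t T) P
  hasLaw_increment : ∀ r s : Icc t T, r ≤ s →
    HasLaw (fun ω => canonicalProcess d t T s ω - canonicalProcess d t T r ω)
      (multivariateGaussian 0 (((s : ℝ) - (r : ℝ)) • (1 : Matrix (Fin d) (Fin d) ℝ))) P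

open Classical in
/-- The Wiener measure. There is exactly one measure satisfying `IsWienerMeasure` for `t ≤ T`
(Wiener's theorem), so that the alternative value `0` is never taken there. -/
noncomputable def wienerMeasure (d : ℕ) (t T : ℝ) : Measure (PathSpace d t T) :=
  if h : ∃ P : Measure (PathSpace d t T), IsWienerMeasure P then h.choose else 0

/-- Lebesgue measure `dr` on the interval `[t, T]`. -/
noncomputable def timeMeasure (t T : ℝ) : Measure (Icc t T) := volume.comap Subtype.val

/-- The product measure `dr × dP₀ᵗ` on `[t, T] × Ωᵗ`. -/
noncomputable def timeWiener (d : ℕ) (t T : ℝ) : Measure (Icc t T × PathSpace d t T) :=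
  (timeMeasure t T).prod (wienerMeasure d t T)

/-! ### Progressive measurability, controls, strategies -/

/-- The progressive σ-field: `D ⊆ [t, T] × Ωᵗ` belongs to it iff for every `s ∈ [t, T]` the trace
`D ∩ ([t, s] × Ωᵗ)` is in `𝓑([t, s]) ⊗ 𝓕ᵗₛ`. -/
@[reducible] def progressive (d : ℕ) (t T : ℝ) : MeasurableSpace (Icc t T × PathSpace d t T) where
  MeasurableSet' D := ∀ s : Icc t T,
    MeasurableSet[(inferInstance : MeasurableSpace (Iic s)).prod (filtration d t T s)]
      ((fun p : Iic s × PathSpace d t T => ((p.1 : Icc t T), p.2)) ⁻¹' D)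
  measurableSet_empty s := by
    rw [preimage_empty]
    exact @MeasurableSet.empty _ (_)
  measurableSet_compl D hD s := by
    rw [preimage_compl]
    exact @MeasurableSet.compl _ _ (_) (hD s)
  measurableSet_iUnion f hf s := by
    rw [preimage_iUnion]
    exact @MeasurableSet.iUnion _ _ (_) _ _ (fun i => hf i s)

section

variable {d : ℕ} {t T : ℝ} {U V : Type*}
  [MetricSpace U] [MeasurableSpace U] [MetricSpace V] [MeasurableSpace V]

/-- Admissible controls over `[t, T]`, with values in `U`, reference point `u₀` and constraint set
`U₀`: progressively measurable processes that take values in `U₀` almost everywhere and are square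
integrable. -/
structure IsControl (u₀ : U) (U₀ : Set U) (μ : Icc t T → PathSpace d t T → U) : Prop where
  measurable : Measurable[progressive d t T] (fun p : Icc t T × PathSpace d t T => μ p.1 p.2)
  mem : ∀ᵐ p ∂(timeWiener d t T), μ p.1 p.2 ∈ U₀
  integrable : ∫⁻ ω, ∫⁻ r, edist (μ r ω) u₀ ^ 2 ∂(timeMeasure t T) ∂(wienerMeasure d t T) < ∞

/-- Admissible strategies over `[t, T]`: functions `α(r, ω, v)` of the opponent's current action
`v ∈ V` with values in `U`, measurable with respect to the progressive σ-field tensor `𝓑(V)`, which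
map `V₀` into `U₀` and are of linear growth in `v`, almost everywhere. -/
structure IsStrategy (u₀ : U) (U₀ : Set U) (v₀ : V) (V₀ : Set V)
    (α : Icc t T → PathSpace d t T → V → U) : Prop where
  measurable : Measurable[(progressive d t T).prod (inferInstance : MeasurableSpace V)]
    (fun p : (Icc t T × PathSpace d t T) × V => α p.1.1 p.1.2 p.2)
  mapsTo : ∀ᵐ p ∂(timeWiener d t T), MapsTo (α p.1 p.2) V₀ U₀
  growth : ∃ κ : ℝ, 0 < κ ∧ ∃ Ψ : Icc t T → PathSpace d t T → ℝ,
    Measurable (fun p : Icc t T × PathSpace d t T => Ψ p.1 p.2) ∧ (∀ r ω, 0 ≤ Ψ r ω) ∧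
    ∫⁻ ω, ∫⁻ r, ENNReal.ofReal (Ψ r ω ^ 2) ∂(timeMeasure t T) ∂(wienerMeasure d t T) < ∞ ∧
    ∀ᵐ p ∂(timeWiener d t T), ∀ v, dist (α p.1 p.2 v) u₀ ≤ Ψ p.1 p.2 + κ * dist v v₀

/-- The smaller class of admissible strategies with the extra path continuity: for every `ε` there
are `δ` and a closed set of probability greater than `1 - ε` on which paths at distance less than
`δ` give actions at distance less than `ε`, uniformly in `(r, v)`. -/
structure IsHatStrategy (u₀ : U) (U₀ : Set U) (v₀ : V) (V₀ : Set V)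
    (α : Icc t T → PathSpace d t T → V → U) : Prop extends IsStrategy u₀ U₀ v₀ V₀ α where
  path_continuity : ∀ ε : ℝ, 0 < ε → ∃ δ : ℝ, 0 < δ ∧ ∃ F : Set (PathSpace d t T), IsClosed F ∧
    1 - ε < (wienerMeasure d t T).real F ∧
    ∀ ω ∈ F, ∀ ω' ∈ F, dist ω ω' < δ →
      ⨆ r, ⨆ v, edist (α r ω v) (α r ω' v) < ENNReal.ofReal ε

end

section

variable {d : ℕ} {t T : ℝ} {U V : Type*}

/-- The process `α⟨ν⟩` induced by a strategy `α` and a control `ν` of the opponent. -/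
def act (α : Icc t T → PathSpace d t T → V → U) (ν : Icc t T → PathSpace d t T → V) :
    Icc t T → PathSpace d t T → U :=
  fun r ω => α r ω (ν r ω)

/-- The shifted process `X^{s,ω}_r(ω') = X_r(ω ⊗ₛ ω')`, `r ∈ [s, T]`, `ω' ∈ Ωˢ`. -/
noncomputable def shift (s : Icc t T) (ω : PathSpace d t T) (X : Icc t T → PathSpace d t T → U) :
    Icc (s : ℝ) T → PathSpace d (s : ℝ) T → U :=
  fun r ω' => X ⟨r, s.2.1.trans r.2.1, r.2.2⟩ (concat s ω ω')

/-- `αhat` is the pasting of `α` with the strategies `αs n i` on `[tₙ, T] × A n i`: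
`αhat(r, ω, v) = αs n i (r, Π_{t,tₙ} ω, v)` on `[tₙ, T] × A n i`, and `αhat = α` at the times before
`τ` and, for the paths outside every `A n i`, also at the times from `τ` on. -/
structure IsPasting (τ : PathSpace d t T → Icc t T) (tn : ℕ → Icc t T) {N : ℕ} {l : Fin N → ℕ}
    (A : (n : Fin N) → Fin (l n) → Set (PathSpace d t T))
    (α : Icc t T → PathSpace d t T → V → U)
    (αs : (n : Fin N) → Fin (l n) →
      Icc (tn n : ℝ) T → PathSpace d (tn n : ℝ) T → V → U)
    (αhat : Icc t T → PathSpace d t T → V → U) : Prop where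
  on_piece : ∀ (n : Fin N) (i : Fin (l n)) (r : Icc (tn n : ℝ) T), ∀ ω ∈ A n i, ∀ v,
    αhat ⟨r, (tn n).2.1.trans r.2.1, r.2.2⟩ ω v = αs n i r (truncate (tn n) ω) v
  before : ∀ (r : Icc t T) (ω : PathSpace d t T), r < τ ω → ∀ v, αhat r ω v = α r ω v
  off_pieces : ∀ (r : Icc t T) (ω : PathSpace d t T), τ ω ≤ r → (∀ n i, ω ∉ A n i) →
    ∀ v, αhat r ω v = α r ω v

end

/-- `ℚ_{t,T} = ([t, T) ∩ ℚ) ∪ {T}`. -/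
def rationalTimes (t T : ℝ) : Set ℝ := (Ico t T ∩ range ((↑) : ℚ → ℝ)) ∪ {T}

end PathGame

namespace PathGame

/-! The pasted strategy is defined by cases on the finitely many sets `[tₙ, T] × A n i`. The proof
combines an exact pathwise part with a measure-theoretic part.

Pathwise: an event of the raw filtration at time `s` depends only on the path up to `s`, and a
stopping time is unchanged when the path is altered after it (`stoppingTime_concat`). So
concatenating at `τ ω` cannot move a path into or out of a piece, and truncation undoes
concatenation. The two shift identities therefore hold for every `ω`; the exceptional null set only
serves to make the shifted control admissible.

Measure-theoretic: truncation maps Wiener measure on `Ωᵗ` to Wiener measure on `Ωˢ`, by uniqueness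
of the latter (`IsWienerMeasure.eq`). Concatenation maps the product of the two to Wiener measure on
`Ωᵗ`, by independence of past and future (`measurePreserving_concat`). The first fact carries the
constraint and growth conditions of the pieces back to `[t, T]`; the second, with Fubini, shows that
almost every shift of a control is a control.

For path continuity, inner regularity replaces the pieces and their complement by compact subsets of
almost full measure. Being disjoint, these lie at positive distance from each other, so nearby paths
use the same strategy (`exists_closed_separated`).

Existence of Wiener measure is never used: if `wienerMeasure` is its default value `0`, the
almost-everywhere claims are void and the path continuity assumed of `α` is contradictory. -/

/-- The inclusion of `[s, T]` into `[t, T]`. -/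
def incl {t T : ℝ} (s : Icc t T) (r : Icc (s : ℝ) T) : Icc t T :=
  ⟨r, s.2.1.trans r.2.1, r.2.2⟩

theorem le_incl {t T : ℝ} (s : Icc t T) (r : Icc (s : ℝ) T) : s ≤ incl s r := r.2.1

/-! ### Algebra and metric properties of truncation and concatenation -/

namespace PathSpace

variable {d : ℕ} {t T : ℝ}

theorem ext_apply {ω ω' : PathSpace d t T} (h : ∀ r, ω r = ω' r) : ω = ω' :=
  DFunLike.ext _ _ h

theorem apply_left (ω : PathSpace d t T) {r : Icc t T} (hr : (r : ℝ) = t) : ω r = 0 := ω.2 r hr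

instance : Zero (PathSpace d t T) := ⟨⟨0, fun _ _ => rfl⟩⟩

theorem zero_apply (r : Icc t T) : (0 : PathSpace d t T) r = 0 := rfl

theorem truncate_apply (s : Icc t T) (ω : PathSpace d t T) (r : Icc (s : ℝ) T) :
    truncate s ω r = ω (incl s r) - ω s := rfl

theorem concat_apply_of_ge {s r : Icc t T} (h : s ≤ r) (ω : PathSpace d t T)
    (ω' : PathSpace d (s : ℝ) T) : concat s ω ω' r = ω s + ω' ⟨r, h, r.2.2⟩ :=
  dif_pos h

theorem concat_apply_incl (s : Icc t T) (ω : PathSpace d t T) (ω' : PathSpace d (s : ℝ) T)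
    (r : Icc (s : ℝ) T) : concat s ω ω' (incl s r) = ω s + ω' r :=
  concat_apply_of_ge (le_incl s r) ω ω'

theorem concat_apply_of_le {s r : Icc t T} (h : r ≤ s) (ω : PathSpace d t T)
    (ω' : PathSpace d (s : ℝ) T) : concat s ω ω' r = ω r := by
  rcases h.eq_or_lt with rfl | h
  · rw [concat_apply_of_ge le_rfl, ω'.apply_left rfl, add_zero]
  · exact dif_neg h.not_ge

theorem truncate_concat (s : Icc t T) (ω : PathSpace d t T) (ω' : PathSpace d (s : ℝ) T) :
    truncate s (concat s ω ω') = ω' := by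
  refine ext_apply fun r => ?_
  rw [truncate_apply, concat_apply_incl, concat_apply_of_le le_rfl, add_sub_cancel_left]

theorem concat_truncate (s : Icc t T) (ω : PathSpace d t T) :
    concat s ω (truncate s ω) = ω := by
  refine ext_apply fun r => ?_
  rcases le_total s r with h | h
  · rw [concat_apply_of_ge h, truncate_apply, add_sub_cancel]; rfl
  · rw [concat_apply_of_le h]

theorem concat_concat_left (s : Icc t T) (ω : PathSpace d t T) (ω' ω'' : PathSpace d (s : ℝ) T) :
    concat s (concat s ω ω') ω'' = concat s ω ω'' := by
  refine ext_apply fun r => ?_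
  rcases le_total s r with h | h
  · rw [concat_apply_of_ge h, concat_apply_of_ge h, concat_apply_of_le le_rfl]
  · rw [concat_apply_of_le h, concat_apply_of_le h, concat_apply_of_le h]

theorem dist_le_iff {ω ω' : PathSpace d t T} {C : ℝ} (hC : 0 ≤ C) :
    dist ω ω' ≤ C ↔ ∀ r, dist (ω r) (ω' r) ≤ C :=
  ContinuousMap.dist_le (f := ω.1) (g := ω'.1) hC

theorem dist_apply_le (ω ω' : PathSpace d t T) (r : Icc t T) : dist (ω r) (ω' r) ≤ dist ω ω' :=
  ContinuousMap.dist_apply_le_dist (f := ω.1) (g := ω'.1) r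

theorem dist_truncate_le (s : Icc t T) (ω ω' : PathSpace d t T) :
    dist (truncate s ω) (truncate s ω') ≤ 2 * dist ω ω' := by
  refine (dist_le_iff (by positivity)).2 fun r => ?_
  rw [truncate_apply, truncate_apply, two_mul]
  exact (dist_sub_sub_le _ _ _ _).trans (add_le_add (dist_apply_le _ _ _) (dist_apply_le _ _ _))

theorem continuous_truncate (s : Icc t T) :
    Continuous (truncate s : PathSpace d t T → PathSpace d (s : ℝ) T) :=
  (LipschitzWith.of_dist_le_mul (K := 2) (dist_truncate_le s)).continuous

/-! ### Borel structure of path space and the raw filtration -/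

instance : SecondCountableTopology (PathSpace d t T) :=
  inferInstanceAs (SecondCountableTopology
    {ω : C(Icc t T, EuclideanSpace ℝ (Fin d)) // ∀ r : Icc t T, (r : ℝ) = t → ω r = 0})

instance : CompleteSpace (PathSpace d t T) := by
  have h : IsClosed {ω : C(Icc t T, EuclideanSpace ℝ (Fin d)) |
      ∀ r : Icc t T, (r : ℝ) = t → ω r = 0} := by
    simp only [ofPred_forall]
    exact isClosed_iInter fun r => isClosed_iInter fun _ =>
      isClosed_eq (continuous_eval_const r) continuous_const
  exact h.completeSpace_coe

theorem measurable_apply (r : Icc t T) : Measurable fun ω : PathSpace d t T => ω r :=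
  (continuous_canonicalProcess r).measurable

/-- The Borel σ-field of the path space is generated by countably many evaluations. -/
theorem measurableEmbedding_denseSeq [Nonempty (Icc t T)] :
    MeasurableEmbedding fun (ω : PathSpace d t T) (n : ℕ) =>
      ω (TopologicalSpace.denseSeq (Icc t T) n) := by
  -- Lusin–Souslin: on a Polish space an injective measurable map of this kind is an embedding, and
  -- continuity of paths gives injectivity.
  refine Measurable.measurableEmbedding (measurable_pi_lambda _ fun n => measurable_apply _) ?_
  intro ω ω' h
  refine DFunLike.coe_injective ?_
  refine (TopologicalSpace.denseRange_denseSeq (Icc t T)).equalizer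
    ω.1.continuous ω'.1.continuous ?_
  exact h

theorem measurable_of_apply {β : Type*} {m : MeasurableSpace β} [Nonempty (Icc t T)]
    {f : β → PathSpace d t T} (h : ∀ r, Measurable fun x => f x r) : Measurable f :=
  measurableEmbedding_denseSeq.measurable_comp_iff.1 (measurable_pi_lambda _ fun _ => h _)

theorem comap_le_of_apply {β : Type*} {m : MeasurableSpace β} [Nonempty (Icc t T)]
    {f : β → PathSpace d t T} (h : ∀ r, Measurable fun x => f x r) :
    MeasurableSpace.comap f inferInstance ≤ m :=
  (measurable_of_apply h).comap_le

theorem filtration_eq (s : Icc t T) :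
    filtration d t T s = ⨆ r ≤ s, MeasurableSpace.comap (fun ω : PathSpace d t T => ω r)
      inferInstance := rfl

theorem measurable_apply_filtration {r s : Icc t T} (h : r ≤ s) :
    Measurable[filtration d t T s] fun ω : PathSpace d t T => ω r := by
  rw [measurable_iff_comap_le, filtration_eq]
  exact le_iSup₂_of_le r h le_rfl

theorem measurable_filtration_of_apply {β : Type*} {m : MeasurableSpace β} {s : Icc t T}
    {f : β → PathSpace d t T} (h : ∀ r ≤ s, Measurable fun x => f x r) :
    Measurable[m, filtration d t T s] f := by
  rw [measurable_iff_comap_le, filtration_eq]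
  simp only [MeasurableSpace.comap_iSup, MeasurableSpace.comap_comp]
  exact iSup₂_le fun r hr => (h r hr).comap_le

/-- Events of `𝓕ᵗₛ` depend on the path up to time `s` only. -/
theorem mem_iff_of_eqOn {s : Icc t T} {A : Set (PathSpace d t T)}
    (hA : MeasurableSet[filtration d t T s] A) {ω ω' : PathSpace d t T}
    (h : ∀ r ≤ s, ω r = ω' r) : ω ∈ A ↔ ω' ∈ A := by
  rw [filtration, Filtration.natural_eq_comap] at hA
  obtain ⟨B, -, rfl⟩ := hA
  have : (fun j : Iic s => canonicalProcess d t T j ω) =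
      fun j : Iic s => canonicalProcess d t T j ω' := funext fun j => h j j.2
  simp only [mem_preimage, this]

theorem concat_mem_iff {s : Icc t T} {A : Set (PathSpace d t T)}
    (hA : MeasurableSet[filtration d t T s] A) (ω : PathSpace d t T)
    (ω' : PathSpace d (s : ℝ) T) : concat s ω ω' ∈ A ↔ ω ∈ A :=
  mem_iff_of_eqOn hA fun _ hr => concat_apply_of_le hr _ _

/-- A stopping time of the raw filtration does not see the path after it has stopped. -/
theorem stoppingTime_concat {τ : PathSpace d t T → Icc t T}
    (hτ : IsStoppingTime (filtration d t T) (fun ω => (τ ω : WithTop (Icc t T))))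
    (ω : PathSpace d t T) (ω' : PathSpace d (τ ω : ℝ) T) : τ (concat (τ ω) ω ω') = τ ω := by
  have hle : ∀ s, MeasurableSet[filtration d t T s] {ω | τ ω ≤ s} := fun s => by
    simpa using hτ.measurableSet_le s
  have h1 : τ (concat (τ ω) ω ω') ≤ τ ω := (concat_mem_iff (hle (τ ω)) ω ω').2 (le_refl (τ ω))
  -- For the converse, the event that `τ` is at most its value at the concatenated path is decided
  -- by that time. By `h1` the two paths still agree then, so `ω` lies in the event too.
  refine le_antisymm h1 ?_
  exact (mem_iff_of_eqOn (hle (τ (concat (τ ω) ω ω')))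
    fun r hr => concat_apply_of_le (hr.trans h1) _ _).1 (le_refl (τ (concat (τ ω) ω ω')))

end PathSpace

open PathSpace

/-! ### Independence of past and future increments -/

section Increments

variable {ι Ω E : Type*} [LinearOrder ι]

/-- Independence of increments is used along monotone sequences indexed by `ℕ`. The sequence lists
`K` in order and then stays at its maximum, which only adds zero increments. -/
theorem exists_monotone_mem_range (K : Finset ι) (hK : K.Nonempty) :
    ∃ u : ℕ → ι, Monotone u ∧ ∀ r ∈ K, r ∈ range u := by
  have hc : 0 < K.card := hK.card_pos
  refine ⟨fun n => K.orderEmbOfFin rfl ⟨min n (K.card - 1), by omega⟩, fun m n h => ?_,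
    fun r hr => ?_⟩
  · refine (K.orderEmbOfFin rfl).monotone ?_
    rw [Fin.mk_le_mk]
    omega
  · have : r ∈ range (K.orderEmbOfFin rfl) := by rwa [K.range_orderEmbOfFin]
    obtain ⟨i, rfl⟩ := this
    refine ⟨i, congrArg _ (Fin.ext ?_)⟩
    have := i.2
    change min (i : ℕ) _ = i
    omega

theorem exists_index_le {u : ℕ → ι} (hu : Monotone u) {m : ℕ} {r : ι} (hr : r ∈ range u)
    (h : r ≤ u m) : ∃ i ≤ m, u i = r := by
  obtain ⟨i, rfl⟩ := hr
  rcases le_total i m with him | him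
  · exact ⟨i, him, rfl⟩
  · exact ⟨m, le_rfl, (hu him).antisymm h⟩

theorem exists_index_ge {u : ℕ → ι} (hu : Monotone u) {m : ℕ} {r : ι} (hr : r ∈ range u)
    (h : u m ≤ r) : ∃ i, m ≤ i ∧ u i = r := by
  obtain ⟨i, rfl⟩ := hr
  rcases le_total i m with him | him
  · exact ⟨m, le_rfl, h.antisymm (hu him)⟩
  · exact ⟨i, him, rfl⟩

variable [AddCommGroup E] [MeasurableSpace E] [MeasurableSub₂ E] [MeasurableAdd₂ E]
  {mΩ : MeasurableSpace Ω} {P : Measure Ω} [IsProbabilityMeasure P] {X : ι → Ω → E}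

/-- For a process with independent increments, the increments before and after a time `s` are
independent. -/
theorem indepFun_past_future (hX : HasIndepIncrements X P) (hm : ∀ r, Measurable (X r)) (s : ι) :
    IndepFun (fun ω (r : Iic s) => X s ω - X r ω) (fun ω (r : Ici s) => X r ω - X s ω) P := by
  classical
  refine IndepFun.process_indepFun_process (fun r => (hm s).sub (hm r))
    (fun r => (hm r).sub (hm s)) fun I J => ?_
  -- With `s = u m` among the nodes, past and future increments are telescoping sums over the
  -- disjoint index sets `k < m` and `m ≤ k`.
  obtain ⟨u, hu, hK⟩ := exists_monotone_mem_range
    (insert s (I.image Subtype.val ∪ J.image Subtype.val)) ⟨s, Finset.mem_insert_self _ _⟩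
  obtain ⟨m, rfl⟩ := hK s (Finset.mem_insert_self _ _)
  have hind : iIndep (fun i => MeasurableSpace.comap
      (fun ω => X (u (i + 1)) ω - X (u i) ω) inferInstance) P := hX.nat hu
  have hdis := indep_iSup_of_disjoint
    (fun i => ((hm (u (i + 1))).sub (hm (u i))).comap_le) hind
    (S := {k | k < m}) (T := {k | m ≤ k})
    (Set.disjoint_left.2 fun k (h1 : k < m) (h2 : m ≤ k) => by omega)
  have key : ∀ (S : Set ℕ) (i j : ℕ), i ≤ j → (∀ k, i ≤ k → k < j → k ∈ S) →
      Measurable[⨆ k ∈ S, MeasurableSpace.comap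
        (fun ω => X (u (k + 1)) ω - X (u k) ω) inferInstance]
        fun ω => X (u j) ω - X (u i) ω := by
    intro S i j hij hS
    have : (fun ω => X (u j) ω - X (u i) ω) =
        fun ω => ∑ k ∈ Finset.Ico i j, (X (u (k + 1)) ω - X (u k) ω) := by
      funext ω
      exact (Finset.sum_Ico_sub (fun k => X (u k) ω) hij).symm
    rw [this]
    refine Finset.measurable_fun_sum _ fun k hk => ?_
    rw [Finset.mem_Ico] at hk
    exact measurable_iff_comap_le.2 (le_iSup₂_of_le k (hS k hk.1 hk.2) le_rfl)
  refine indep_of_indep_of_le_left (indep_of_indep_of_le_right hdis ?_) ?_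
  · rw [MeasurableSpace.comap_process_pi]
    refine iSup_le fun r => measurable_iff_comap_le.1 ?_
    obtain ⟨j, hj, hr⟩ := exists_index_ge hu (hK r.1.1 (Finset.mem_insert_of_mem
      (Finset.mem_union_right _ (Finset.mem_image_of_mem _ r.2)))) r.1.2
    rw [← hr]
    exact key _ m j hj fun k h1 _ => h1
  · rw [MeasurableSpace.comap_process_pi]
    refine iSup_le fun r => measurable_iff_comap_le.1 ?_
    obtain ⟨j, hj, hr⟩ := exists_index_le hu (hK r.1.1 (Finset.mem_insert_of_mem
      (Finset.mem_union_left _ (Finset.mem_image_of_mem _ r.2)))) r.1.2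
    rw [← hr]
    exact key _ j m hj fun k _ h1 => h1

end Increments

/-! ### Uniqueness of Wiener measure and the Markov property -/

variable {d : ℕ} {t T : ℝ}

theorem IsWienerMeasure.map_increments {P : Measure (PathSpace d t T)} (hP : IsWienerMeasure P)
    {u : ℕ → Icc t T} (hu : Monotone u) :
    P.map (fun ω i => ω (u (i + 1)) - ω (u i)) =
      Measure.infinitePi fun i => multivariateGaussian 0
        (((u (i + 1) : ℝ) - (u i : ℝ)) • (1 : Matrix (Fin d) (Fin d) ℝ)) := by
  have h := iIndepFun.map_fun_eq_infinitePi_map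
    (fun i => (measurable_apply (d := d) (u (i + 1))).sub (measurable_apply (u i)))
    (hP.hasIndepIncrements.nat hu)
  refine h.trans (congrArg _ (funext fun i => ?_))
  exact (hP.hasLaw_increment _ _ (hu i.le_succ)).map_eq

/-- Paths vanish at time `t`, so their values at finitely many times are partial sums of increments,
whose joint law is prescribed. Finite-dimensional laws determine the law of the whole process, and
evaluation along a dense sequence of times carries this back to the Borel σ-field of the path space.
-/
theorem IsWienerMeasure.eq (hT : t ≤ T) {P Q : Measure (PathSpace d t T)}
    (hP : IsWienerMeasure P) (hQ : IsWienerMeasure Q) : P = Q := by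
  classical
  have := hP.isProbabilityMeasure
  have := hQ.isProbabilityMeasure
  let b : Icc t T := ⟨t, left_mem_Icc.2 hT⟩
  have : Nonempty (Icc t T) := ⟨b⟩
  have hm : Measurable fun (ω : PathSpace d t T) (r : Icc t T) => ω r :=
    measurable_pi_lambda _ measurable_apply
  have hfin : ∀ I : Finset (Icc t T), P.map (fun ω => I.restrict fun r => ω r) =
      Q.map (fun ω => I.restrict fun r => ω r) := by
    intro I
    obtain ⟨u, hu, hK⟩ := exists_monotone_mem_range (insert b I) ⟨b, Finset.mem_insert_self _ _⟩
    obtain ⟨m, hmb⟩ := hK b (Finset.mem_insert_self _ _)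
    have hidx : ∀ r : I, ∃ i, m ≤ i ∧ u i = r := fun r =>
      exists_index_ge hu (hK r (Finset.mem_insert_of_mem r.2)) (hmb.trans_le r.1.2.1)
    choose j hj hjr using hidx
    have hsum : (fun (ω : PathSpace d t T) => I.restrict fun r => ω r) =
        (fun (x : ℕ → EuclideanSpace ℝ (Fin d)) (r : I) => ∑ k ∈ Finset.Ico m (j r), x k) ∘
          fun ω i => ω (u (i + 1)) - ω (u i) := by
      funext ω r
      have := Finset.sum_Ico_sub (fun k => ω (u k)) (hj r)
      rw [hmb, ω.apply_left (r := b) rfl, sub_zero, hjr] at this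
      exact this.symm
    have hg : Measurable fun (x : ℕ → EuclideanSpace ℝ (Fin d)) (r : I) =>
        ∑ k ∈ Finset.Ico m (j r), x k :=
      measurable_pi_lambda _ fun r => Finset.measurable_fun_sum _ fun k _ => measurable_pi_apply k
    have hi : Measurable fun (ω : PathSpace d t T) (i : ℕ) => ω (u (i + 1)) - ω (u i) :=
      measurable_pi_lambda _ fun i => (measurable_apply _).sub (measurable_apply _)
    rw [hsum, ← Measure.map_map hg hi, ← Measure.map_map hg hi, hP.map_increments hu,
      hQ.map_increments hu]
  have hproc : P.map (fun ω (r : Icc t T) => ω r) = Q.map (fun ω (r : Icc t T) => ω r) := by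
    have h1 := isProjectiveLimit_map (X := canonicalProcess d t T) (P := P) hm.aemeasurable
    have h2 := isProjectiveLimit_map (X := canonicalProcess d t T) (P := Q) hm.aemeasurable
    exact h1.unique fun I => (h2 I).trans (hfin I).symm
  have he := measurableEmbedding_denseSeq (d := d) (t := t) (T := T)
  have hmap := congrArg (Measure.map fun (x : Icc t T → EuclideanSpace ℝ (Fin d)) (n : ℕ) =>
    x (TopologicalSpace.denseSeq (Icc t T) n)) hproc
  have hπ : Measurable fun (x : Icc t T → EuclideanSpace ℝ (Fin d)) (n : ℕ) =>
    x (TopologicalSpace.denseSeq (Icc t T) n) := measurable_pi_lambda _ fun n => measurable_pi_apply _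
  rw [Measure.map_map hπ hm, Measure.map_map hπ hm] at hmap
  rw [← he.comap_map P, ← he.comap_map Q]
  exact congrArg _ hmap

/-- Either the Wiener measure has its defining property, or it is the default value `0`, for which
almost-everywhere statements are void. -/
theorem wienerMeasure_eq_zero_or (d : ℕ) (t T : ℝ) :
    wienerMeasure d t T = 0 ∨ IsWienerMeasure (wienerMeasure d t T) := by
  unfold wienerMeasure
  split_ifs with h
  · exact Or.inr h.choose_spec
  · exact Or.inl rfl

theorem IsWienerMeasure.eq_wienerMeasure (hT : t ≤ T) {P : Measure (PathSpace d t T)}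
    (hP : IsWienerMeasure P) : P = wienerMeasure d t T := by
  have h : ∃ P : Measure (PathSpace d t T), IsWienerMeasure P := ⟨P, hP⟩
  rw [wienerMeasure, dif_pos h]
  exact hP.eq hT h.choose_spec

/-- Truncation subtracts a quantity constant in time, so increments are preserved. Besides
identifying the image law, this shows that a Wiener measure exists on `[s, T]` as soon as one exists
on `[t, T]`. -/
theorem IsWienerMeasure.map_truncate {P : Measure (PathSpace d t T)} (hP : IsWienerMeasure P)
    (s : Icc t T) : IsWienerMeasure (P.map (truncate s)) := by
  have hm : Measurable (truncate s : PathSpace d t T → _) := (continuous_truncate s).measurable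
  have := hP.isProbabilityMeasure
  have hinc : ∀ (r r' : Icc (s : ℝ) T) (ω : PathSpace d t T),
      truncate s ω r' - truncate s ω r = ω (incl s r') - ω (incl s r) := fun r r' ω => by
    rw [truncate_apply, truncate_apply, sub_sub_sub_cancel_right]
  refine ⟨Measure.isProbabilityMeasure_map hm.aemeasurable, fun n u hu => ?_, fun r r' h => ?_⟩
  · have h1 := hP.hasIndepIncrements n (fun i => incl s (u i)) fun i j hij => hu hij
    have hmeas : ∀ i : Fin n, Measurable fun (ω : PathSpace d (s : ℝ) T) =>
      canonicalProcess d s T (u i.succ) ω - canonicalProcess d s T (u i.castSucc) ω := fun i =>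
      (measurable_apply _).sub (measurable_apply _)
    rw [iIndepFun_iff_measure_inter_preimage_eq_mul] at h1 ⊢
    intro S sets hsets
    have h2 := h1 S hsets
    have hpre : ∀ i : Fin n, truncate s ⁻¹' ((fun (ω : PathSpace d (s : ℝ) T) =>
        canonicalProcess d s T (u i.succ) ω - canonicalProcess d s T (u i.castSucc) ω) ⁻¹' sets i) =
        (fun (ω : PathSpace d t T) => canonicalProcess d t T (incl s (u i.succ)) ω -
          canonicalProcess d t T (incl s (u i.castSucc)) ω) ⁻¹' sets i := fun i => by
      ext ω
      exact iff_of_eq (congrArg (· ∈ sets i) (hinc (u i.castSucc) (u i.succ) ω))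
    rw [Measure.map_apply hm (Finset.measurableSet_biInter _ fun i hi => hmeas i (hsets i hi))]
    simp only [preimage_iInter, hpre]
    rw [h2]
    refine Finset.prod_congr rfl fun i hi => ?_
    rw [Measure.map_apply hm (hmeas i (hsets i hi)), hpre]
  · have hmeas : Measurable fun (ω : PathSpace d (s : ℝ) T) =>
      canonicalProcess d s T r' ω - canonicalProcess d s T r ω :=
      (measurable_apply _).sub (measurable_apply _)
    refine ⟨hmeas.aemeasurable, ?_⟩
    rw [Measure.map_map hmeas hm]
    exact (congrArg (fun f => P.map f) (funext fun ω => hinc r r' ω)).trans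
      (hP.hasLaw_increment (incl s r) (incl s r') h).map_eq

theorem measurePreserving_truncate (hW : IsWienerMeasure (wienerMeasure d t T)) (s : Icc t T) :
    MeasurePreserving (truncate s) (wienerMeasure d t T) (wienerMeasure d s T) :=
  ⟨(continuous_truncate s).measurable, (hW.map_truncate s).eq_wienerMeasure s.2.2⟩

theorem measurable_concat (s : Icc t T) :
    Measurable fun p : PathSpace d t T × PathSpace d (s : ℝ) T => concat s p.1 p.2 := by
  have : Nonempty (Icc t T) := ⟨s⟩
  refine measurable_of_apply fun r => ?_
  rcases le_total s r with h | h
  · simp only [concat_apply_of_ge h]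
    exact ((measurable_apply s).comp measurable_fst).add ((measurable_apply _).comp measurable_snd)
  · simp only [concat_apply_of_le h]
    exact (measurable_apply r).comp measurable_fst

/-- Under the Wiener measure, the path stopped at `s` and the truncated path are independent. -/
theorem indepFun_stopped_truncate (hW : IsWienerMeasure (wienerMeasure d t T)) (s : Icc t T) :
    IndepFun (fun ω => concat s ω 0) (truncate s) (wienerMeasure d t T) := by
  have := hW.isProbabilityMeasure
  have hT : t ≤ T := s.2.1.trans s.2.2
  have : Nonempty (Icc t T) := ⟨s⟩
  have : Nonempty (Icc (s : ℝ) T) := ⟨⟨s, le_rfl, s.2.2⟩⟩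
  let b : Iic s := ⟨⟨t, left_mem_Icc.2 hT⟩, s.2.1⟩
  have h := indepFun_past_future hW.hasIndepIncrements measurable_apply s
  rw [IndepFun_iff_Indep] at h ⊢
  refine indep_of_indep_of_le_left (indep_of_indep_of_le_right h ?_) ?_
  · refine comap_le_of_apply fun r => ?_
    exact (measurable_pi_apply (⟨incl s r, le_incl s r⟩ : Ici s)).comp
      (comap_measurable fun (ω : PathSpace d t T) (r : Ici s) =>
        canonicalProcess d t T r ω - canonicalProcess d t T s ω)
  · have key : ∀ r : Iic s, Measurable[MeasurableSpace.comap (fun ω (r : Iic s) =>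
        canonicalProcess d t T s ω - canonicalProcess d t T r ω) MeasurableSpace.pi]
        fun ω : PathSpace d t T => ω r := by
      intro r
      have h0 := comap_measurable (m := MeasurableSpace.pi) fun ω (r : Iic s) =>
        canonicalProcess d t T s ω - canonicalProcess d t T r ω
      have h1 := (measurable_pi_apply b).comp h0
      have h2 := (measurable_pi_apply r).comp h0
      -- Since `ω b = 0` at the initial time, path values up to `s` can be recovered from the
      -- backward increments from `s`.
      have : (fun ω : PathSpace d t T => ω r) = fun ω => (ω s - ω b) - (ω s - ω r) := by
        funext ω
        rw [ω.apply_left (r := b) rfl]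
        abel
      rw [this]
      exact h1.sub h2
    refine comap_le_of_apply fun r => ?_
    rcases le_total s r with h | h
    · simp only [concat_apply_of_ge h, PathSpace.zero_apply, add_zero]
      exact key ⟨s, le_refl s⟩
    · simp only [concat_apply_of_le h]
      exact key ⟨r, h⟩

/-- The Markov property: the concatenation of independent Brownian paths is a Brownian path. -/
theorem measurePreserving_concat (hW : IsWienerMeasure (wienerMeasure d t T)) (s : Icc t T) :
    MeasurePreserving (fun p : PathSpace d t T × PathSpace d (s : ℝ) T => concat s p.1 p.2)
      ((wienerMeasure d t T).prod (wienerMeasure d s T)) (wienerMeasure d t T) := by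
  have := hW.isProbabilityMeasure
  have htr := measurePreserving_truncate hW s
  have := (hW.map_truncate s).isProbabilityMeasure
  rw [htr.map_eq] at this
  have hc := measurable_concat (d := d) s
  have hm_left : Measurable fun ω : PathSpace d t T => concat s ω (0 : PathSpace d (s : ℝ) T) :=
    hc.comp (measurable_id.prodMk measurable_const)
  refine ⟨hc, ?_⟩
  have h1 := (indepFun_iff_map_prod_eq_prod_map_map hm_left.aemeasurable
    htr.measurable.aemeasurable).1 (indepFun_stopped_truncate hW s)
  have h2 := Measure.map_prod_map (wienerMeasure d t T) (wienerMeasure d s T) hm_left measurable_id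
  rw [htr.map_eq] at h1
  rw [Measure.map_id] at h2
  have h3 := congrArg (Measure.map fun p : PathSpace d t T × PathSpace d (s : ℝ) T =>
    concat s p.1 p.2) (h1.trans h2)
  rw [Measure.map_map hc (hm_left.prodMk htr.measurable),
    Measure.map_map hc (hm_left.prodMap measurable_id)] at h3
  -- A path is the concatenation of its stopped part and its truncation, and concatenation sees its
  -- left argument only through the stopped part. So the joint law in `h3` yields the claim.
  have e1 : ((fun p : PathSpace d t T × PathSpace d (s : ℝ) T => concat s p.1 p.2) ∘
      fun ω => (concat s ω 0, truncate s ω)) = id := by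
    funext ω
    exact (concat_concat_left s ω 0 _).trans (concat_truncate s ω)
  have e2 : ((fun p : PathSpace d t T × PathSpace d (s : ℝ) T => concat s p.1 p.2) ∘
      Prod.map (fun ω => concat s ω 0) id) = fun p => concat s p.1 p.2 := by
    funext p
    exact concat_concat_left s p.1 0 p.2
  rw [e1, e2, Measure.map_id] at h3
  exact h3.symm

/-! ### Changing the initial time -/

/-- The retraction `r ↦ max r s` of `[t, T]` onto `[s, T]`. -/
def retract (s r : Icc t T) : Icc (s : ℝ) T :=
  ⟨max (r : ℝ) s, le_max_right _ _, max_le r.2.2 s.2.2⟩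

theorem retract_incl (s : Icc t T) (r : Icc (s : ℝ) T) : retract s (incl s r) = r :=
  Subtype.ext (max_eq_left r.2.1)

theorem measurable_retract (s : Icc t T) : Measurable (retract s) :=
  ((measurable_subtype_coe.max measurable_const).subtype_mk)

theorem measurable_incl (s : Icc t T) : Measurable (incl s) :=
  measurable_subtype_coe.subtype_mk

/-- Progressive measurability can be checked on the traces. -/
theorem measurable_progressive_of_trace {d' : ℕ} {t' T' : ℝ}
    {g : Icc t T × PathSpace d t T → Icc t' T' × PathSpace d' t' T'}
    (h : ∀ u : Icc t T, ∃ u' : Icc t' T', (∀ p, p.1 ≤ u → (g p).1 ≤ u') ∧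
      Measurable[(inferInstance : MeasurableSpace (Iic u)).prod (filtration d t T u)]
        (fun p : Iic u × PathSpace d t T => (g (p.1, p.2)).1) ∧
      Measurable[(inferInstance : MeasurableSpace (Iic u)).prod (filtration d t T u),
        filtration d' t' T' u'] (fun p : Iic u × PathSpace d t T => (g (p.1, p.2)).2)) :
    Measurable[progressive d t T, progressive d' t' T'] g := by
  intro D hD u
  obtain ⟨u', hle, h1, h2⟩ := h u
  have h3 : Measurable[(inferInstance : MeasurableSpace (Iic u)).prod (filtration d t T u),
      (inferInstance : MeasurableSpace (Iic u')).prod (filtration d' t' T' u')]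
      fun p : Iic u × PathSpace d t T =>
        ((⟨(g (p.1, p.2)).1, hle _ p.1.2⟩ : Iic u'), (g (p.1, p.2)).2) :=
    Measurable.prodMk (f := fun p : Iic u × PathSpace d t T =>
      (⟨(g (p.1, p.2)).1, hle _ p.1.2⟩ : Iic u')) h1.subtype_mk h2
  exact h3 (hD u')

/-- By time `u` the truncated path is known up to `max u s`. For `u ≤ s` that is the single time
`s`, where it vanishes; the retraction keeps the time coordinate meaningful there. -/
theorem measurable_progressive_truncate (s : Icc t T) :
    Measurable[progressive d t T, progressive d s T]
      fun p => (retract s p.1, truncate s p.2) := by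
  refine measurable_progressive_of_trace fun u =>
    ⟨retract s u, fun p hp => ?_, ?_, ?_⟩
  · exact max_le_max_right (s : ℝ) (show (p.1 : ℝ) ≤ u from hp)
  · exact (measurable_retract s).comp (measurable_subtype_coe.comp
      (@measurable_fst _ _ _ (filtration d t T u)))
  · refine @measurable_filtration_of_apply _ _ _ _ (_) _ _ fun r hr => ?_
    simp only [truncate_apply]
    rcases le_total s u with hsu | hus
    · have hr' : incl s r ≤ u := (show (r : ℝ) ≤ max (u : ℝ) s from hr).trans_eq (max_eq_left hsu)
      exact ((measurable_apply_filtration hr').comp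
        (@measurable_snd _ _ _ (filtration d t T u))).sub
        ((measurable_apply_filtration hsu).comp (@measurable_snd _ _ _ (filtration d t T u)))
    · have hr' : incl s r = s := le_antisymm
        ((show (r : ℝ) ≤ max (u : ℝ) s from hr).trans_eq (max_eq_right hus)) (le_incl s r)
      simp only [hr', sub_self]
      exact @measurable_const _ _ _ (_) _

theorem measurable_progressive_concat (s : Icc t T) (ω : PathSpace d t T) :
    Measurable[progressive d s T, progressive d t T]
      fun p => (incl s p.1, concat s ω p.2) := by
  refine measurable_progressive_of_trace fun u =>
    ⟨incl s u, fun p hp => hp, ?_, ?_⟩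
  · exact (measurable_incl s).comp (measurable_subtype_coe.comp
      (@measurable_fst _ _ _ (filtration d s T u)))
  · refine @measurable_filtration_of_apply _ _ _ _ (_) _ _ fun r hr => ?_
    rcases le_total s r with hsr | hrs
    · simp only [concat_apply_of_ge hsr]
      exact ((measurable_apply_filtration (show (⟨r, hsr, r.2.2⟩ : Icc (s : ℝ) T) ≤ u from hr)).comp
        (@measurable_snd _ _ _ (filtration d s T u))).const_add _
    · simp only [concat_apply_of_le hrs]
      exact @measurable_const _ _ _ (_) _

/-- Before `s` the traces are empty, and from `s` on `A` already belongs to the filtration. This is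
why pasting along the pieces does not destroy progressive measurability. -/
theorem measurableSet_progressive {s : Icc t T} {A : Set (PathSpace d t T)}
    (hA : MeasurableSet[filtration d t T s] A) :
    MeasurableSet[progressive d t T] {p | s ≤ p.1 ∧ p.2 ∈ A} := by
  intro u
  rcases le_or_gt s u with hsu | hus
  · have h1 : MeasurableSet {r : Iic u | s ≤ (r : Icc t T)} :=
      measurableSet_le measurable_const measurable_subtype_coe
    exact @MeasurableSet.prod _ _ _ (filtration d t T u) _ _ h1 ((filtration d t T).mono hsu A hA)
  · have : (fun p : Iic u × PathSpace d t T => ((p.1 : Icc t T), p.2)) ⁻¹'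
        {p | s ≤ p.1 ∧ p.2 ∈ A} = ∅ := by
      ext p
      simp only [mem_preimage, mem_ofPred_eq, mem_empty_iff_false, iff_false, not_and]
      exact fun h => absurd (h.trans p.1.2) hus.not_ge
    rw [this]
    exact @MeasurableSet.empty _ (_)

theorem progressive_le (d : ℕ) (t T : ℝ) :
    progressive d t T ≤ (inferInstance : MeasurableSpace (Icc t T × PathSpace d t T)) := by
  intro D hD
  by_cases hT : t ≤ T
  · let e : Icc t T := ⟨T, right_mem_Icc.2 hT⟩
    have h1 : Measurable[inferInstance, (inferInstance : MeasurableSpace (Iic e)).prod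
        (filtration d t T e)]
        fun p : Icc t T × PathSpace d t T => ((⟨p.1, p.1.2.2⟩ : Iic e), p.2) :=
      Measurable.prodMk (f := fun p : Icc t T × PathSpace d t T => (⟨p.1, p.1.2.2⟩ : Iic e))
        measurable_fst.subtype_mk
        (measurable_snd.mono le_rfl ((filtration d t T).le e))
    exact h1 (hD e)
  · have : IsEmpty (Icc t T) := ⟨fun r => hT (r.2.1.trans r.2.2)⟩
    rw [Subsingleton.elim D ∅]
    exact MeasurableSet.empty

/-! ### The product measures -/

instance : IsFiniteMeasure (timeMeasure t T) := by
  refine ⟨?_⟩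
  rw [timeMeasure, (MeasurableEmbedding.subtype_coe measurableSet_Icc).comap_apply,
    image_univ, Subtype.range_coe]
  exact measure_Icc_lt_top

instance : IsFiniteMeasure (wienerMeasure d t T) := by
  rcases wienerMeasure_eq_zero_or d t T with h | h
  · rw [h]
    infer_instance
  · have := h.isProbabilityMeasure
    infer_instance

instance : IsFiniteMeasure (timeWiener d t T) :=
  inferInstanceAs (IsFiniteMeasure ((timeMeasure t T).prod (wienerMeasure d t T)))

theorem measurePreserving_incl (s : Icc t T) :
    MeasurePreserving (incl s) (timeMeasure s T) ((timeMeasure t T).restrict (Ici s)) := by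
  refine ⟨measurable_incl s, Measure.ext fun B hB => ?_⟩
  rw [Measure.map_apply (measurable_incl s) hB, Measure.restrict_apply hB, timeMeasure, timeMeasure,
    (MeasurableEmbedding.subtype_coe measurableSet_Icc).comap_apply,
    (MeasurableEmbedding.subtype_coe measurableSet_Icc).comap_apply]
  congr 1
  ext x
  constructor
  · rintro ⟨r, hr, rfl⟩
    exact ⟨incl s r, ⟨hr, le_incl s r⟩, rfl⟩
  · rintro ⟨r, ⟨hr, hs⟩, rfl⟩
    exact ⟨⟨r, hs, r.2.2⟩, hr, rfl⟩

theorem measurePreserving_retract (s : Icc t T) :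
    MeasurePreserving (retract s) ((timeMeasure t T).restrict (Ici s)) (timeMeasure s T) := by
  refine ⟨measurable_retract s, ?_⟩
  rw [← (measurePreserving_incl s).map_eq, Measure.map_map (measurable_retract s)
    (measurable_incl s)]
  exact (congrArg (fun f => Measure.map f _) (funext (retract_incl s))).trans Measure.map_id

theorem restrict_timeWiener (s : Icc t T) :
    ((timeMeasure t T).restrict (Ici s)).prod (wienerMeasure d t T) =
      (timeWiener d t T).restrict (Ici s ×ˢ univ) := by
  rw [timeWiener, ← Measure.prod_restrict, Measure.restrict_univ]

theorem measurePreserving_retract_truncate (hW : IsWienerMeasure (wienerMeasure d t T))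
    (s : Icc t T) :
    MeasurePreserving (fun p : Icc t T × PathSpace d t T => (retract s p.1, truncate s p.2))
      ((timeWiener d t T).restrict (Ici s ×ˢ univ)) (timeWiener d s T) := by
  rw [← restrict_timeWiener]
  exact (measurePreserving_retract s).prod (measurePreserving_truncate hW s)

theorem ae_retract_truncate (hW : IsWienerMeasure (wienerMeasure d t T)) (s : Icc t T)
    {p : Icc (s : ℝ) T × PathSpace d (s : ℝ) T → Prop} (h : ∀ᵐ q ∂(timeWiener d s T), p q) :
    ∀ᵐ q ∂(timeWiener d t T), s ≤ q.1 → p (retract s q.1, truncate s q.2) := by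
  have h1 := (measurePreserving_retract_truncate hW s).quasiMeasurePreserving.ae h
  rw [ae_restrict_iff' (measurableSet_Ici.prod MeasurableSet.univ)] at h1
  filter_upwards [h1] with q hq hs using hq ⟨hs, mem_univ _⟩

/-- The concatenation property with a time variable carried along. Through Fubini, a null set or a
finite integral over `[s, T] × Ωᵗ` becomes the same over `[s, T] × Ωˢ` for almost every initial
path. -/
theorem measurePreserving_incl_concat (hW : IsWienerMeasure (wienerMeasure d t T)) (s : Icc t T) :
    MeasurePreserving (fun q : PathSpace d t T × (Icc (s : ℝ) T × PathSpace d (s : ℝ) T) =>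
        (incl s q.2.1, concat s q.1 q.2.2))
      ((wienerMeasure d t T).prod (timeWiener d s T))
      ((timeWiener d t T).restrict (Ici s ×ˢ univ)) := by
  rw [← restrict_timeWiener]
  have h1 := (measurePreserving_prodAssoc (wienerMeasure d t T) (timeMeasure s T)
    (wienerMeasure d s T)).symm
  have h2 := (Measure.measurePreserving_swap (μ := wienerMeasure d t T)
    (ν := timeMeasure s T)).prod (MeasurePreserving.id (wienerMeasure d s T))
  have h3 := measurePreserving_prodAssoc (timeMeasure s T) (wienerMeasure d t T)
    (wienerMeasure d s T)
  have h4 := (measurePreserving_incl s).prod (measurePreserving_concat hW s)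
  exact h4.comp (h3.comp (h2.comp h1))

/-! ### Shifted controls -/

section Control

variable {V : Type*} [MetricSpace V] [MeasurableSpace V] [OpensMeasurableSpace V]

/-- Almost every shift of an admissible control is an admissible control. -/
theorem IsControl.ae_shift {v₀ : V} {V₀ : Set V} {ν : Icc t T → PathSpace d t T → V}
    (hν : IsControl v₀ V₀ ν) (s : Icc t T) :
    ∀ᵐ ω ∂(wienerMeasure d t T), IsControl v₀ V₀ (shift s ω ν) := by
  rcases wienerMeasure_eq_zero_or d t T with h0 | hW
  · simp [h0]
  have hG := measurePreserving_incl_concat hW s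
  have hmem := Measure.ae_ae_of_ae_prod
    (hG.quasiMeasurePreserving.ae (ae_restrict_of_ae hν.mem))
  have hf : Measurable fun p : Icc t T × PathSpace d t T => edist (ν p.1 p.2) v₀ ^ 2 :=
    ((continuous_id.edist continuous_const).measurable.comp
      (hν.measurable.mono (progressive_le d t T) le_rfl)).pow_const 2
  have hfin : ∫⁻ q, edist (ν (incl s q.2.1) (concat s q.1 q.2.2)) v₀ ^ 2
      ∂((wienerMeasure d t T).prod (timeWiener d s T)) < ∞ := by
    refine (hG.lintegral_comp hf).trans_lt ((setLIntegral_le_lintegral _ _).trans_lt ?_)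
    rw [timeWiener, lintegral_prod_symm _ hf.aemeasurable]
    exact hν.integrable
  have hfG := hf.comp hG.measurable
  replace hfin := (lintegral_prod _ hfG.aemeasurable).symm.trans_lt hfin
  filter_upwards [hmem, ae_lt_top hfG.lintegral_prod_right' hfin.ne] with ω h1 h2
  refine ⟨?_, h1, ?_⟩
  · exact hν.measurable.comp (measurable_progressive_concat s ω)
  · exact (lintegral_prod_symm _ (hfG.comp measurable_prodMk_left).aemeasurable).symm.trans_lt h2

end Control

/-! ### Pasting -/

section Paste

variable {U V ι : Type*}

open Classical in
/-- The strategy equal to `αs i (r, Π_{t,sᵢ} ω, v)` on `[sᵢ, T] × A i` and to `α` elsewhere. -/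
noncomputable def paste (s : ι → Icc t T) (A : ι → Set (PathSpace d t T))
    (α : Icc t T → PathSpace d t T → V → U)
    (αs : (i : ι) → Icc (s i : ℝ) T → PathSpace d (s i : ℝ) T → V → U) :
    Icc t T → PathSpace d t T → V → U :=
  fun r ω v => if h : ∃ i, s i ≤ r ∧ ω ∈ A i then
    αs h.choose (retract (s h.choose) r) (truncate (s h.choose) ω) v else α r ω v

variable {s : ι → Icc t T} {A : ι → Set (PathSpace d t T)}
  {α : Icc t T → PathSpace d t T → V → U}
  {αs : (i : ι) → Icc (s i : ℝ) T → PathSpace d (s i : ℝ) T → V → U}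

/-- Disjointness leaves only one possible index, so the choice in the definition is immaterial. -/
theorem paste_of_mem (hA : Pairwise fun i j => Disjoint (A i) (A j)) {i : ι} {r : Icc t T}
    {ω : PathSpace d t T} (hr : s i ≤ r) (hω : ω ∈ A i) :
    paste s A α αs r ω = αs i (retract (s i) r) (truncate (s i) ω) := by
  have h : ∃ i, s i ≤ r ∧ ω ∈ A i := ⟨i, hr, hω⟩
  have hi : h.choose = i := by
    by_contra hne
    exact Set.disjoint_left.1 (hA hne) h.choose_spec.2 hω
  funext v
  rw [paste, dif_pos h, hi]

theorem paste_of_forall_not {r : Icc t T} {ω : PathSpace d t T}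
    (h : ∀ i, ¬ (s i ≤ r ∧ ω ∈ A i)) : paste s A α αs r ω = α r ω := by
  funext v
  rw [paste, dif_neg (not_exists.2 h)]

theorem measurable_of_cover {β γ : Type*} {mβ : MeasurableSpace β} {mγ : MeasurableSpace γ}
    [Countable ι] {D : ι → Set β} (hD : ∀ i, MeasurableSet (D i)) {f g₀ : β → γ} {g : ι → β → γ}
    (hg : ∀ i, Measurable (g i)) (hg₀ : Measurable g₀) (h : ∀ i, ∀ x ∈ D i, f x = g i x)
    (h₀ : ∀ x, (∀ i, x ∉ D i) → f x = g₀ x) : Measurable f := by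
  intro S hS
  have : f ⁻¹' S = (⋃ i, D i ∩ g i ⁻¹' S) ∪ ((⋂ i, (D i)ᶜ) ∩ g₀ ⁻¹' S) := by
    ext x
    simp only [mem_preimage, mem_union, mem_iUnion, mem_inter_iff, mem_iInter, mem_compl_iff]
    by_cases hx : ∀ i, x ∉ D i
    · rw [h₀ x hx]
      exact ⟨fun hS => Or.inr ⟨hx, hS⟩, fun h => h.elim (fun ⟨i, hi, _⟩ => absurd hi (hx i)) And.right⟩
    · refine ⟨fun hS => ?_, fun h' => ?_⟩
      · push Not at hx
        obtain ⟨i, hi⟩ := hx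
        exact Or.inl ⟨i, hi, h i x hi ▸ hS⟩
      · rcases h' with ⟨i, hi, hS⟩ | ⟨hx', -⟩
        · rwa [h i x hi]
        · exact absurd hx' hx
  rw [this]
  exact (MeasurableSet.iUnion fun i => (hD i).inter (hg i hS)).union
    ((MeasurableSet.iInter fun i => (hD i).compl).inter (hg₀ hS))

/-- As `A i` is decided by time `s i`, every continuation of `ω` stays in `A i`, and truncating the
continued path returns the continuation. -/
theorem shift_act_paste_of_mem (hA : Pairwise fun i j => Disjoint (A i) (A j)) {i : ι}
    (hAm : MeasurableSet[filtration d t T (s i)] (A i)) {ω : PathSpace d t T} (hω : ω ∈ A i)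
    (ν : Icc t T → PathSpace d t T → V) :
    shift (s i) ω (act (paste s A α αs) ν) = act (αs i) (shift (s i) ω ν) := by
  funext r ω'
  have h := paste_of_mem (α := α) (αs := αs) hA (le_incl (s i) r)
    ((concat_mem_iff hAm ω ω').2 hω)
  rw [retract_incl, truncate_concat] at h
  exact congrFun h _

/-- If a continuation of `ω` after `τ ω` lay in `A i`, then `τ` would equal `s i` there, hence also
at `ω`. Then `A i` would be decided before the two paths separate, forcing `ω ∈ A i`. -/
theorem shift_act_paste_of_notMem {τ : PathSpace d t T → Icc t T}
    (hτ : IsStoppingTime (filtration d t T) (fun ω => (τ ω : WithTop (Icc t T))))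
    (hAm : ∀ i, MeasurableSet[filtration d t T (s i)] (A i)) (hAτ : ∀ i, ∀ ω ∈ A i, τ ω = s i)
    {ω : PathSpace d t T} (hω : ∀ i, ω ∉ A i) (ν : Icc t T → PathSpace d t T → V) :
    shift (τ ω) ω (act (paste s A α αs) ν) = shift (τ ω) ω (act α ν) := by
  funext r ω'
  refine congrFun (paste_of_forall_not fun i hi => hω i ?_) _
  have hs : τ ω = s i := (stoppingTime_concat hτ ω ω').symm.trans (hAτ i _ hi.2)
  exact (mem_iff_of_eqOn (hAm i) fun r hr => concat_apply_of_le (hr.trans_eq hs.symm) ω ω').1 hi.2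

variable [MetricSpace U] [MeasurableSpace U] [MetricSpace V] [MeasurableSpace V]
  {u₀ : U} {U₀ : Set U} {v₀ : V} {V₀ : Set V}

/-- Gives access to the stability of L² under sums and measure-preserving pullbacks. -/
theorem memLp_two_timeWiener_iff {Ψ : Icc t T → PathSpace d t T → ℝ}
    (hΨ : Measurable fun p : Icc t T × PathSpace d t T => Ψ p.1 p.2) :
    MemLp (fun p : Icc t T × PathSpace d t T => Ψ p.1 p.2) 2 (timeWiener d t T) ↔
      ∫⁻ ω, ∫⁻ r, ENNReal.ofReal (Ψ r ω ^ 2) ∂(timeMeasure t T) ∂(wienerMeasure d t T) < ∞ := by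
  have h1 : ∫⁻ ω, ∫⁻ r, ENNReal.ofReal (Ψ r ω ^ 2) ∂(timeMeasure t T) ∂(wienerMeasure d t T) =
      ∫⁻ p, ‖Ψ p.1 p.2‖ₑ ^ (2 : ℝ≥0∞).toReal ∂(timeWiener d t T) := by
    rw [timeWiener, lintegral_prod_symm _ (hΨ.enorm.pow_const _).aemeasurable]
    refine lintegral_congr fun ω => lintegral_congr fun r => ?_
    rw [ENNReal.toReal_ofNat, ENNReal.rpow_ofNat, Real.enorm_eq_ofReal_abs,
      ← ENNReal.ofReal_pow (abs_nonneg _), sq_abs]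
  rw [h1, ← eLpNorm_lt_top_iff_lintegral_rpow_enorm_lt_top two_ne_zero ENNReal.ofNat_ne_top]
  exact ⟨fun h => h.2, fun h => ⟨hΨ.aestronglyMeasurable, h⟩⟩

theorem measurable_paste [Countable ι] (hA : Pairwise fun i j => Disjoint (A i) (A j))
    (hAm : ∀ i, MeasurableSet[filtration d t T (s i)] (A i))
    (hα : IsStrategy u₀ U₀ v₀ V₀ α) (hαs : ∀ i, IsStrategy u₀ U₀ v₀ V₀ (αs i)) :
    Measurable[(progressive d t T).prod (inferInstance : MeasurableSpace V)]
      (fun p : (Icc t T × PathSpace d t T) × V => paste s A α αs p.1.1 p.1.2 p.2) := by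
  have hfst := @measurable_fst (Icc t T × PathSpace d t T) V (progressive d t T) ‹_›
  refine @measurable_of_cover _ _ _ ((progressive d t T).prod inferInstance) _ _
    (fun i => {p | s i ≤ p.1.1 ∧ p.1.2 ∈ A i})
    (fun i => hfst (measurableSet_progressive (hAm i))) _ _
    (fun i p => αs i (retract (s i) p.1.1) (truncate (s i) p.1.2) p.2) (fun i => ?_) hα.measurable
    (fun i p hp => ?_) fun p hp => ?_
  · exact (hαs i).measurable.comp
      (Measurable.prodMk (f := fun p : (Icc t T × PathSpace d t T) × V =>
        (retract (s i) p.1.1, truncate (s i) p.1.2))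
        ((measurable_progressive_truncate (s i)).comp hfst)
        (@measurable_snd (Icc t T × PathSpace d t T) V (progressive d t T) ‹_›))
  · exact congrFun (paste_of_mem hA hp.1 hp.2) _
  · exact congrFun (paste_of_forall_not hp) _

theorem mapsTo_paste [Countable ι] (hA : Pairwise fun i j => Disjoint (A i) (A j))
    (hα : IsStrategy u₀ U₀ v₀ V₀ α) (hαs : ∀ i, IsStrategy u₀ U₀ v₀ V₀ (αs i)) :
    ∀ᵐ p ∂(timeWiener d t T), MapsTo (paste s A α αs p.1 p.2) V₀ U₀ := by
  rcases wienerMeasure_eq_zero_or d t T with h0 | hW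
  · simp [timeWiener, h0]
  have h := ae_all_iff.2 fun i => ae_retract_truncate hW (s i) (hαs i).mapsTo
  filter_upwards [hα.mapsTo, h] with p h1 h2
  by_cases hp : ∀ i, ¬ (s i ≤ p.1 ∧ p.2 ∈ A i)
  · rwa [paste_of_forall_not hp]
  · push Not at hp
    obtain ⟨i, hi, hω⟩ := hp
    rw [paste_of_mem hA hi hω]
    exact h2 i hi

/-- With finitely many pieces, the sums of the growth constants and of the pulled-back bounds
dominate each single one, all terms being nonnegative. -/
theorem growth_paste [Fintype ι] (hA : Pairwise fun i j => Disjoint (A i) (A j))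
    (hα : IsStrategy u₀ U₀ v₀ V₀ α) (hαs : ∀ i, IsStrategy u₀ U₀ v₀ V₀ (αs i)) :
    ∃ κ : ℝ, 0 < κ ∧ ∃ Ψ : Icc t T → PathSpace d t T → ℝ,
      Measurable (fun p : Icc t T × PathSpace d t T => Ψ p.1 p.2) ∧ (∀ r ω, 0 ≤ Ψ r ω) ∧
      ∫⁻ ω, ∫⁻ r, ENNReal.ofReal (Ψ r ω ^ 2) ∂(timeMeasure t T) ∂(wienerMeasure d t T) < ∞ ∧
      ∀ᵐ p ∂(timeWiener d t T), ∀ v,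
        dist (paste s A α αs p.1 p.2 v) u₀ ≤ Ψ p.1 p.2 + κ * dist v v₀ := by
  rcases wienerMeasure_eq_zero_or d t T with h0 | hW
  · exact ⟨1, one_pos, 0, measurable_const, fun _ _ => le_rfl, by simp [h0],
      by simp [timeWiener, h0]⟩
  obtain ⟨κ₀, hκ₀, Ψ₀, hΨ₀m, hΨ₀0, hΨ₀i, hΨ₀⟩ := hα.growth
  choose κ hκ Ψ hΨm hΨ0 hΨi hΨ using fun i => (hαs i).growth
  have hgm : ∀ i, Measurable fun p : Icc t T × PathSpace d t T =>
      (retract (s i) p.1, truncate (s i) p.2) := fun i =>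
    (measurePreserving_retract_truncate hW (s i)).measurable
  -- The cut-off at `s i` is needed because the retraction sends all earlier times to `s i` and
  -- preserves measure only on `[s i, T]`.
  let Φ : ι → Icc t T × PathSpace d t T → ℝ := fun i => (Ici (s i) ×ˢ univ).indicator
    fun p => Ψ i (retract (s i) p.1) (truncate (s i) p.2)
  have hD : ∀ i, MeasurableSet (Ici (s i) ×ˢ (univ : Set (PathSpace d t T))) := fun i =>
    measurableSet_Ici.prod MeasurableSet.univ
  have hΦm : ∀ i, Measurable (Φ i) := fun i => ((hΨm i).comp (hgm i)).indicator (hD i)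
  have hΦ0 : ∀ i p, 0 ≤ Φ i p := fun i p => indicator_nonneg (fun _ _ => hΨ0 i _ _) p
  have hΦi : ∀ i, MemLp (Φ i) 2 (timeWiener d t T) := fun i =>
    (memLp_indicator_iff_restrict (hD i)).2 (((memLp_two_timeWiener_iff (hΨm i)).2
      (hΨi i)).comp_measurePreserving (measurePreserving_retract_truncate hW (s i)))
  have hm : Measurable fun p : Icc t T × PathSpace d t T => Ψ₀ p.1 p.2 + ∑ i, Φ i (p.1, p.2) :=
    hΨ₀m.add (Finset.measurable_fun_sum _ fun i _ => hΦm i)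
  refine ⟨κ₀ + ∑ i, κ i, add_pos_of_pos_of_nonneg hκ₀ (Finset.sum_nonneg fun i _ => (hκ i).le),
    fun r ω => Ψ₀ r ω + ∑ i, Φ i (r, ω), hm,
    fun r ω => add_nonneg (hΨ₀0 r ω) (Finset.sum_nonneg fun i _ => hΦ0 i _), ?_, ?_⟩
  · rw [← memLp_two_timeWiener_iff hm]
    exact ((memLp_two_timeWiener_iff hΨ₀m).2 hΨ₀i).add (memLp_finsetSum _ fun i _ => hΦi i)
  · have h := ae_all_iff.2 fun i => ae_retract_truncate hW (s i) (hΨ i)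
    filter_upwards [hΨ₀, h] with p h1 h2 v
    have hsum : ∀ i, Φ i p ≤ ∑ i, Φ i p := fun i =>
      Finset.single_le_sum (fun i _ => hΦ0 i p) (Finset.mem_univ i)
    have hκs : ∀ i, κ i ≤ ∑ i, κ i := fun i =>
      Finset.single_le_sum (fun i _ => (hκ i).le) (Finset.mem_univ i)
    have hv : 0 ≤ dist v v₀ := dist_nonneg
    by_cases hp : ∀ i, ¬ (s i ≤ p.1 ∧ p.2 ∈ A i)
    · rw [paste_of_forall_not hp]
      refine (h1 v).trans (add_le_add (le_add_of_nonneg_right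
        (Finset.sum_nonneg fun i _ => hΦ0 i p)) (mul_le_mul_of_nonneg_right
        (le_add_of_nonneg_right (Finset.sum_nonneg fun i _ => (hκ i).le)) hv))
    · push Not at hp
      obtain ⟨i, hi, hω⟩ := hp
      rw [paste_of_mem hA hi hω]
      have hΦp : Φ i p = Ψ i (retract (s i) p.1) (truncate (s i) p.2) :=
        indicator_of_mem (show p ∈ Ici (s i) ×ˢ univ from ⟨hi, mem_univ _⟩) _
      refine (h2 i hi v).trans (add_le_add ?_ (mul_le_mul_of_nonneg_right
        ((hκs i).trans (le_add_of_nonneg_left hκ₀.le)) hv))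
      rw [← hΦp]
      exact (hsum i).trans (le_add_of_nonneg_left (hΨ₀0 _ _))

theorem IsStrategy.paste [Fintype ι] (hA : Pairwise fun i j => Disjoint (A i) (A j))
    (hAm : ∀ i, MeasurableSet[filtration d t T (s i)] (A i))
    (hα : IsStrategy u₀ U₀ v₀ V₀ α) (hαs : ∀ i, IsStrategy u₀ U₀ v₀ V₀ (αs i)) :
    IsStrategy u₀ U₀ v₀ V₀ (paste s A α αs) :=
  ⟨measurable_paste hA hAm hα hαs, mapsTo_paste hA hα hαs, growth_paste hA hα hαs⟩

theorem exists_pos_forall_le_of_finite [Finite ι] {f : ι → ℝ} (hf : ∀ i, 0 < f i) :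
    ∃ δ > 0, ∀ i, δ ≤ f i := by
  rcases isEmpty_or_nonempty ι with h | h
  · exact ⟨1, one_pos, fun i => h.elim i⟩
  · obtain ⟨i, hi⟩ := Finite.exists_min f
    exact ⟨f i, hf i, hi⟩

/-- A finite measurable partition is, up to small measure, a partition into closed sets at positive
distance from each other. -/
theorem exists_closed_separated {X : Type*} [MetricSpace X] [CompleteSpace X]
    [SecondCountableTopology X] [MeasurableSpace X] [BorelSpace X] (P : Measure X)
    [IsFiniteMeasure P] [Fintype ι] {B : ι → Set X} (hB : ∀ i, MeasurableSet (B i))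
    (hdis : Pairwise fun i j => Disjoint (B i) (B j)) (hcov : ⋃ i, B i = univ) {ε : ℝ}
    (hε : 0 < ε) :
    ∃ K : ι → Set X, (∀ i, IsClosed (K i)) ∧ (∀ i, K i ⊆ B i) ∧ P.real (⋃ i, K i)ᶜ < ε ∧
      ∃ δ > 0, ∀ i j, ∀ x ∈ K i, ∀ y ∈ K j, dist x y < δ → i = j := by
  -- The extra `1` keeps the total of the errors strictly below `ε` and covers an empty index type.
  have hη : 0 < ε / (Fintype.card ι + 1) := by positivity
  have hK : ∀ i, ∃ K ⊆ B i, IsCompact K ∧ P (B i \ K) < ENNReal.ofReal (ε / (Fintype.card ι + 1)) :=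
    fun i => (hB i).exists_isCompact_sdiff_lt (measure_ne_top P _) (ENNReal.ofReal_pos.2 hη).ne'
  choose K hKB hKc hKP using hK
  refine ⟨K, fun i => (hKc i).isClosed, hKB, ?_, ?_⟩
  · have hsub : (⋃ i, K i)ᶜ ⊆ ⋃ i, B i \ K i := fun x hx => by
      obtain ⟨i, hi⟩ := mem_iUnion.1 (hcov.symm ▸ mem_univ x)
      exact mem_iUnion.2 ⟨i, hi, fun h => hx (mem_iUnion.2 ⟨i, h⟩)⟩
    have hreal : ∀ i, P.real (B i \ K i) ≤ ε / (Fintype.card ι + 1) := fun i =>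
      ENNReal.toReal_le_of_le_ofReal hη.le (hKP i).le
    calc P.real (⋃ i, K i)ᶜ ≤ ∑ i, P.real (B i \ K i) :=
          (measureReal_mono hsub).trans (measureReal_iUnion_fintype_le _)
      _ ≤ ∑ _i : ι, ε / (Fintype.card ι + 1) := Finset.sum_le_sum fun i _ => hreal i
      _ = Fintype.card ι * (ε / (Fintype.card ι + 1)) := by simp
      _ < ε := by
          rw [mul_div_assoc', div_lt_iff₀ (by positivity)]
          nlinarith
  -- Disjoint compact sets have disjoint thickenings; the smallest radius over the finitely many
  -- pairs serves for all.
  · have hsep : ∀ p : {p : ι × ι // p.1 ≠ p.2}, ∃ δ > 0,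
        Disjoint (Metric.thickening δ (K p.1.1)) (Metric.thickening δ (K p.1.2)) := fun p =>
      ((hdis p.2).mono (hKB _) (hKB _)).exists_thickenings (hKc _) (hKc _).isClosed
    choose δ hδ hdisδ using hsep
    obtain ⟨δ', hδ', hle⟩ := exists_pos_forall_le_of_finite hδ
    refine ⟨δ', hδ', fun i j x hx y hy hxy => ?_⟩
    by_contra hij
    refine Set.disjoint_left.1 (hdisδ ⟨(i, j), hij⟩) ?_
      (Metric.self_subset_thickening (hδ _) _ hy)
    exact Metric.mem_thickening_iff.2 ⟨x, hx, (dist_comm y x).trans_lt (hxy.trans_le (hle _))⟩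

/-- Intersect the good closed sets of all strategies, pulled back by truncation where needed, with a
union of separated closed subsets of the pieces and of their complement. Close paths in this set lie
in the same cell, so one single strategy has to be compared with itself. -/
theorem IsHatStrategy.paste [Fintype ι] (hA : Pairwise fun i j => Disjoint (A i) (A j))
    (hAm : ∀ i, MeasurableSet[filtration d t T (s i)] (A i))
    (hα : IsHatStrategy u₀ U₀ v₀ V₀ α) (hαs : ∀ i, IsHatStrategy u₀ U₀ v₀ V₀ (αs i)) :
    IsHatStrategy u₀ U₀ v₀ V₀ (paste s A α αs) := by
  refine ⟨hα.toIsStrategy.paste hA hAm fun i => (hαs i).toIsStrategy, fun ε hε => ?_⟩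
  rcases wienerMeasure_eq_zero_or d t T with h0 | hW
  -- For the zero measure the hypothesis at `1 / 2` would read `1 / 2 < 0`.
  · obtain ⟨-, -, F, -, hF, -⟩ := hα.path_continuity (1 / 2) (by norm_num)
    rw [h0, measureReal_zero_apply] at hF
    norm_num at hF
  have hprob := hW.isProbabilityMeasure
  set P := wienerMeasure d t T
  -- One share of the error for each piece, one for `α` and one for separating the cells.
  set η : ℝ := ε / (Fintype.card ι + 2) with hη_def
  have hη : 0 < η := by positivity
  have hηε : η < ε := div_lt_self hε (by have := (Fintype.card ι).cast_nonneg (α := ℝ); linarith)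
  obtain ⟨δ₀, hδ₀, F₀, hF₀c, hF₀, hα₀⟩ := hα.path_continuity η hη
  choose δ hδ F hFc hF hαF using fun i => (hαs i).path_continuity η hη
  obtain ⟨δ₁, hδ₁, hδ₁le⟩ := exists_pos_forall_le_of_finite hδ
  have hAb : ∀ i, MeasurableSet (A i) := fun i => (filtration d t T).le _ _ (hAm i)
  -- The index `none` stands for the complement of all the pieces, which makes the family a
  -- partition.
  let B : Option ι → Set (PathSpace d t T) := fun o => o.elim (⋂ i, (A i)ᶜ) A
  obtain ⟨K, hKc, hKB, hKP, δ₂, hδ₂, hsep⟩ := exists_closed_separated P (B := B)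
    (by rintro (_ | i)
        · exact MeasurableSet.iInter fun i => (hAb i).compl
        · exact hAb i)
    (by rintro (_ | i) (_ | j) hij
        · exact absurd rfl hij
        · exact Set.disjoint_left.2 fun ω h1 h2 => mem_iInter.1 h1 j h2
        · exact Set.disjoint_left.2 fun ω h1 h2 => mem_iInter.1 h2 i h1
        · exact hA fun h => hij (congrArg some h))
    (by refine eq_univ_of_forall fun ω => ?_
        by_cases h : ∃ i, ω ∈ A i
        · exact mem_iUnion.2 ⟨some h.choose, h.choose_spec⟩
        · exact mem_iUnion.2 ⟨none, mem_iInter.2 fun i hi => h ⟨i, hi⟩⟩) hη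
  have htrc : ∀ i, IsClosed (truncate (s i) ⁻¹' F i : Set (PathSpace d t T)) := fun i =>
    (hFc i).preimage (continuous_truncate (s i))
  have hFcl : IsClosed (F₀ ∩ (⋂ i, truncate (s i) ⁻¹' F i) ∩ ⋃ o, K o) :=
    (hF₀c.inter (isClosed_iInter htrc)).inter (isClosed_iUnion_of_finite hKc)
  -- `δ₁` is halved because truncation may double distances.
  refine ⟨min δ₀ (min (δ₁ / 2) δ₂), by positivity, _, hFcl, ?_, ?_⟩
  · have h1 : P.real F₀ᶜ < η := by
      rw [probReal_compl_eq_one_sub hF₀c.measurableSet]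
      linarith
    have h2 : ∀ i, P.real (truncate (s i) ⁻¹' F i)ᶜ ≤ η := fun i => by
      rw [probReal_compl_eq_one_sub (htrc i).measurableSet,
        (measurePreserving_truncate hW (s i)).measureReal_preimage
          (hFc i).measurableSet.nullMeasurableSet]
      linarith [hF i]
    have h3 : P.real (F₀ ∩ (⋂ i, truncate (s i) ⁻¹' F i) ∩ ⋃ o, K o)ᶜ < ε := by
      rw [compl_inter, compl_inter, compl_iInter]
      calc _ ≤ P.real F₀ᶜ + P.real (⋃ i, (truncate (s i) ⁻¹' F i)ᶜ) + P.real (⋃ o, K o)ᶜ :=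
            (measureReal_union_le _ _).trans (add_le_add_left (measureReal_union_le _ _) _)
        _ ≤ P.real F₀ᶜ + ∑ i, P.real (truncate (s i) ⁻¹' F i)ᶜ + P.real (⋃ o, K o)ᶜ := by
            gcongr
            exact measureReal_iUnion_fintype_le _
        _ ≤ P.real F₀ᶜ + ∑ _i : ι, η + P.real (⋃ o, K o)ᶜ := by
            gcongr with i
            exact h2 i
        _ < η + ∑ _i : ι, η + η := by gcongr
        _ = ε := by
            simp only [Finset.sum_const, Finset.card_univ, nsmul_eq_mul, hη_def]
            field_simp
            ring
    rw [probReal_compl_eq_one_sub hFcl.measurableSet] at h3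
    linarith
  · rintro ω ⟨⟨hω₀, hωF⟩, hωK⟩ ω' ⟨⟨hω'₀, hω'F⟩, hω'K⟩ hd
    obtain ⟨o, ho⟩ := mem_iUnion.1 hωK
    obtain ⟨o', ho'⟩ := mem_iUnion.1 hω'K
    obtain rfl := hsep o o' ω ho ω' ho'
      (hd.trans_le ((min_le_right _ _).trans (min_le_right _ _)))
    have hsame : ∀ i, ω ∈ A i ↔ ω' ∈ A i := by
      intro i
      rcases o with _ | j
      · exact iff_of_false (fun h => mem_iInter.1 (hKB _ ho) i h)
          fun h => mem_iInter.1 (hKB _ ho') i h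
      · by_cases hij : i = j
        · subst hij
          exact iff_of_true (hKB _ ho) (hKB _ ho')
        · exact iff_of_false (fun h => Set.disjoint_left.1 (hA hij) h (hKB _ ho))
            fun h => Set.disjoint_left.1 (hA hij) h (hKB _ ho')
    -- Bounds for each `(r, v)` only give a weak inequality for the supremum; strictness comes from
    -- `η < ε`.
    refine lt_of_le_of_lt (iSup₂_le fun r v => ?_) ((ENNReal.ofReal_lt_ofReal_iff hε).2 hηε)
    by_cases hp : ∀ i, ¬ (s i ≤ r ∧ ω ∈ A i)
    · rw [paste_of_forall_not hp, paste_of_forall_not fun i h => hp i ⟨h.1, (hsame i).2 h.2⟩]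
      exact (le_iSup₂ (f := fun r v => edist (α r ω v) (α r ω' v)) r v).trans
        (hα₀ ω hω₀ ω' hω'₀ (hd.trans_le (min_le_left _ _))).le
    · push Not at hp
      obtain ⟨i, hi, hω⟩ := hp
      rw [paste_of_mem hA hi hω, paste_of_mem hA hi ((hsame i).1 hω)]
      refine (le_iSup₂ (f := fun r v => edist (αs i r (truncate (s i) ω) v)
        (αs i r (truncate (s i) ω') v)) (retract (s i) r) v).trans
        (hαF i _ (mem_iInter.1 hωF i) _ (mem_iInter.1 hω'F i) ?_).le
      have h1 := dist_truncate_le (s i) ω ω'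
      have h2 := hd.trans_le ((min_le_right _ _).trans (min_le_left _ _))
      linarith [hδ₁le i]

end Paste

/-! ### The pasting of strategies along a stopping time -/

/-- Pairs `(n, i)` are treated as one finite index. Nothing distinguishes the two players, so
exchanging the roles of `U` and `V` gives the second half of the theorem. -/
theorem exists_isPasting {U V : Type*}
    [MetricSpace U] [MeasurableSpace U] [MetricSpace V] [MeasurableSpace V]
    [OpensMeasurableSpace V] {u₀ : U} {v₀ : V} {U₀ : Set U} {V₀ : Set V}
    {τ : PathSpace d t T → Icc t T}
    (hτ : IsStoppingTime (filtration d t T) (fun ω => (τ ω : WithTop (Icc t T))))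
    {tn : ℕ → Icc t T} {N : ℕ} {l : Fin N → ℕ} {A : (n : Fin N) → Fin (l n) → Set (PathSpace d t T)}
    (hAmeas : ∀ (n : Fin N) (i : Fin (l n)), MeasurableSet[filtration d t T (tn n)] (A n i))
    (hAτ : ∀ (n : Fin N) (i : Fin (l n)), A n i ⊆ {ω | τ ω = tn n})
    (hAdisj : Pairwise fun p q : (n : Fin N) × Fin (l n) => Disjoint (A p.1 p.2) (A q.1 q.2))
    {α : Icc t T → PathSpace d t T → V → U}
    {αs : (n : Fin N) → Fin (l n) → Icc (tn n : ℝ) T → PathSpace d (tn n : ℝ) T → V → U}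
    (hα : IsStrategy u₀ U₀ v₀ V₀ α)
    (hαs : ∀ (n : Fin N) (i : Fin (l n)), IsStrategy u₀ U₀ v₀ V₀ (αs n i)) :
    ∃ αhat : Icc t T → PathSpace d t T → V → U,
      IsPasting τ tn A α αs αhat ∧
      IsStrategy u₀ U₀ v₀ V₀ αhat ∧
      (IsHatStrategy u₀ U₀ v₀ V₀ α →
        (∀ (n : Fin N) (i : Fin (l n)), IsHatStrategy u₀ U₀ v₀ V₀ (αs n i)) →
        IsHatStrategy u₀ U₀ v₀ V₀ αhat) ∧
      ∀ ν : Icc t T → PathSpace d t T → V, IsControl v₀ V₀ ν →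
        ∀ᵐ ω ∂(wienerMeasure d t T),
          (∀ (n : Fin N) (i : Fin (l n)), ω ∈ A n i →
            IsControl v₀ V₀ (shift (tn n) ω ν) ∧
            shift (tn n) ω (act αhat ν) = act (αs n i) (shift (tn n) ω ν)) ∧
          ((∀ (n : Fin N) (i : Fin (l n)), ω ∉ A n i) →
            shift (τ ω) ω (act αhat ν) = shift (τ ω) ω (act α ν)) := by
  let s : (n : Fin N) × Fin (l n) → Icc t T := fun p => tn p.1
  let B : (n : Fin N) × Fin (l n) → Set (PathSpace d t T) := fun p => A p.1 p.2
  let αB : (p : (n : Fin N) × Fin (l n)) → Icc (s p : ℝ) T → PathSpace d (s p : ℝ) T → V → U :=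
    fun p => αs p.1 p.2
  refine ⟨paste s B α αB, ⟨?_, ?_, ?_⟩, ?_, ?_, ?_⟩
  · intro n i r ω hω v
    have h := paste_of_mem (s := s) (α := α) (αs := αB) hAdisj (i := ⟨n, i⟩) (r := incl (tn n) r)
      (le_incl (tn n) r) hω
    rw [retract_incl] at h
    exact congrFun h v
  -- On a piece, `τ` equals the pasting time, so no piece is active before `τ`.
  · intro r ω hr v
    refine congrFun (paste_of_forall_not fun p hp => ?_) v
    exact (hr.trans_eq (hAτ p.1 p.2 hp.2)).not_ge hp.1
  · intro r ω _ hω v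
    exact congrFun (paste_of_forall_not fun p hp => hω p.1 p.2 hp.2) v
  · exact hα.paste hAdisj (fun p => hAmeas p.1 p.2) fun p => hαs p.1 p.2
  · exact fun h hs => h.paste hAdisj (fun p => hAmeas p.1 p.2) fun p => hs p.1 p.2
  · intro ν hν
    filter_upwards [ae_all_iff.2 fun n : Fin N => hν.ae_shift (tn n)] with ω hω
    refine ⟨fun n i hi => ⟨hω n, ?_⟩, fun h => ?_⟩
    · exact shift_act_paste_of_mem (s := s) (αs := αB) hAdisj (i := ⟨n, i⟩) (hAmeas n i) hi ν
    · exact shift_act_paste_of_notMem (s := s) (A := B) (αs := αB) hτ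
        (fun p => hAmeas p.1 p.2)
        (fun p ω hω => hAτ p.1 p.2 hω) (fun p => h p.1 p.2) ν

end PathGame

open PathGame PathGame.PathSpace in
theorem proposition4p7 {d : ℕ} {t T : ℝ} (hT : 0 < T) (ht : t ∈ Icc 0 T)
    {U V : Type*}
    [MetricSpace U] [TopologicalSpace.SeparableSpace U] [MeasurableSpace U] [BorelSpace U]
    [MetricSpace V] [TopologicalSpace.SeparableSpace V] [MeasurableSpace V] [BorelSpace V]
    (u₀ : U) (v₀ : V) (U₀ : Set U) (V₀ : Set V) (hU₀ : U₀.Nonempty) (hV₀ : V₀.Nonempty)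
    -- a stopping time with values in `{tₙ} ⊆ ℚ_{t,T}`
    (τ : PathSpace d t T → Icc t T)
    (hτ : IsStoppingTime (filtration d t T) (fun ω => (τ ω : WithTop (Icc t T))))
    (tn : ℕ → Icc t T) (htn : ∀ n, (tn n : ℝ) ∈ rationalTimes t T)
    (hτtn : ∀ ω, τ ω ∈ range tn)
    -- finitely many disjoint sets `A n i ⊆ {τ = tₙ}` in `𝓕ᵗ_{tₙ}`
    (N : ℕ) (l : Fin N → ℕ) (A : (n : Fin N) → Fin (l n) → Set (PathSpace d t T))
    (hAmeas : ∀ (n : Fin N) (i : Fin (l n)), MeasurableSet[filtration d t T (tn n)] (A n i))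
    (hAτ : ∀ (n : Fin N) (i : Fin (l n)), A n i ⊆ {ω | τ ω = tn n})
    (hAdisj : Pairwise fun p q : (n : Fin N) × Fin (l n) => Disjoint (A p.1 p.2) (A q.1 q.2)) :
    -- player I
    (∀ (α : Icc t T → PathSpace d t T → V → U)
      (αs : (n : Fin N) → Fin (l n) → Icc (tn n : ℝ) T → PathSpace d (tn n : ℝ) T → V → U),
      IsStrategy u₀ U₀ v₀ V₀ α → (∀ (n : Fin N) (i : Fin (l n)), IsStrategy u₀ U₀ v₀ V₀ (αs n i)) →
      ∃ αhat : Icc t T → PathSpace d t T → V → U,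
        IsPasting τ tn A α αs αhat ∧
        IsStrategy u₀ U₀ v₀ V₀ αhat ∧
        (IsHatStrategy u₀ U₀ v₀ V₀ α → (∀ (n : Fin N) (i : Fin (l n)), IsHatStrategy u₀ U₀ v₀ V₀ (αs n i)) →
          IsHatStrategy u₀ U₀ v₀ V₀ αhat) ∧
        ∀ ν : Icc t T → PathSpace d t T → V, IsControl v₀ V₀ ν →
          ∀ᵐ ω ∂(wienerMeasure d t T),
            (∀ (n : Fin N) (i : Fin (l n)), ω ∈ A n i →
              IsControl v₀ V₀ (shift (tn n) ω ν) ∧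
              shift (tn n) ω (act αhat ν) = act (αs n i) (shift (tn n) ω ν)) ∧
            ((∀ (n : Fin N) (i : Fin (l n)), ω ∉ A n i) → shift (τ ω) ω (act αhat ν) = shift (τ ω) ω (act α ν))) ∧
    -- player II
    (∀ (β : Icc t T → PathSpace d t T → U → V)
      (βs : (n : Fin N) → Fin (l n) → Icc (tn n : ℝ) T → PathSpace d (tn n : ℝ) T → U → V),
      IsStrategy v₀ V₀ u₀ U₀ β → (∀ (n : Fin N) (i : Fin (l n)), IsStrategy v₀ V₀ u₀ U₀ (βs n i)) →
      ∃ βhat : Icc t T → PathSpace d t T → U → V,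
        IsPasting τ tn A β βs βhat ∧
        IsStrategy v₀ V₀ u₀ U₀ βhat ∧
        (IsHatStrategy v₀ V₀ u₀ U₀ β → (∀ (n : Fin N) (i : Fin (l n)), IsHatStrategy v₀ V₀ u₀ U₀ (βs n i)) →
          IsHatStrategy v₀ V₀ u₀ U₀ βhat) ∧
        ∀ μ : Icc t T → PathSpace d t T → U, IsControl u₀ U₀ μ →
          ∀ᵐ ω ∂(wienerMeasure d t T),
            (∀ (n : Fin N) (i : Fin (l n)), ω ∈ A n i →
              IsControl u₀ U₀ (shift (tn n) ω μ) ∧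
              shift (tn n) ω (act βhat μ) = act (βs n i) (shift (tn n) ω μ)) ∧
            ((∀ (n : Fin N) (i : Fin (l n)), ω ∉ A n i) → shift (τ ω) ω (act βhat μ) = shift (τ ω) ω (act β μ))) := 
    ⟨fun _ _ hα hαs => exists_isPasting hτ hAmeas hAτ hAdisj hα hαs,
      fun _ _ hβ hβs => exists_isPasting hτ hAmeas hAτ hAdisj hβ hβs⟩
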